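/- Let $a,b\in\mathbb R$, $R>0$, $I=(0,R)$, with all function spaces complex-valued. In $L_2(I)$ let $A$ be the unbounded operator $Ay=-y'''+iay''-by'$ with domain $D(A)=\{y\in H^3(I): y(0)=y(R)=y'(R)=0\}$; it generates a strongly continuous semigroup $\{e^{tA}\}_{t\ge 0}$ on $L_2(I)$, so that $u(t,\cdot)=e^{tA}u_0$ is the solution of $$iu_t+au_{xx}+ibu_x+iu_{xxx}=0,\qquad u|_{t=0}=u_0,\qquad u|_{x=0}=u|_{x=R}=u_x|_{x=R}=0.$$ Suppose that either $3b+a^2\le 0$, or $3b+a^2>0$ and $$R\ne 2\pi\sqrt{\frac{k^2+kl+l^2}{3b+a^2}}\qquad\text{for all integers } k,l\ge 1.$$ Then for every $T>0$ the following holds. There is a unique bounded linear operator $P:L_2(I)\to L_2(0,T)$ such that $(Pu_0)(t)=\partial_x(e^{tA}u_0)(0)$ for almost every $t\in(0,T)$ whenever $u_0\in D(A)$, and there is a constant $c>0$, depending only on $T$, $R$ and the coefficients $a,b$, such that for every $u_0\in L_2(I)$ $$\|u_0\|_{L_2(I)}\le c\,\|Pu_0\|_{L_2(0,T)}.$$ 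-/

import Mathlib

open MeasureTheory Filter Topology Set

/-- The complex Hilbert space `L₂(0, r)`. -/
abbrev L2Interval (r : ℝ) : Type :=
  Lp ℂ 2 (volume.restrict (Ioo (0 : ℝ) r))

/-- `f` is an absolutely continuous primitive of `g` on `[0, R]`, that is,
`f(x) = f(0) + ∫₀ˣ g` for every `x ∈ [0, R]`. -/
def IsPrimitiveOn (R : ℝ) (f g : ℝ → ℂ) : Prop :=
  ∀ x ∈ Icc (0 : ℝ) R, f x = f 0 + ∫ s in (0 : ℝ)..x, g s

/-- `y ∈ H³(0, R)`, with (absolutely) continuous representatives `y₀, y₁, y₂` of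
`y, y', y''` on `[0, R]`, and with `y₃ ∈ L₂(0, R)` representing `y'''`. -/
structure IsH3Representative (R : ℝ) (y : L2Interval R) (y₀ y₁ y₂ y₃ : ℝ → ℂ) : Prop where
  ae_eq : ∀ᵐ x ∂(volume.restrict (Ioo (0 : ℝ) R)), y x = y₀ x
  deriv_zero : IsPrimitiveOn R y₀ y₁
  deriv_one : IsPrimitiveOn R y₁ y₂
  deriv_two : IsPrimitiveOn R y₂ y₃
  memLp : MemLp y₃ 2 (volume.restrict (Ioo (0 : ℝ) R))

/-- The graph of the unbounded operator `A y = -y''' + i a y'' - b y'` in `L₂(0, R)` with domain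
`D(A) = {y ∈ H³(0, R) : y(0) = y(R) = y'(R) = 0}`: `HNLSGraph a b R y z` says that
`y ∈ D(A)` and `A y = z`. -/
def HNLSGraph (a b R : ℝ) (y z : L2Interval R) : Prop :=
  ∃ y₀ y₁ y₂ y₃ : ℝ → ℂ, IsH3Representative R y y₀ y₁ y₂ y₃ ∧
    y₀ 0 = 0 ∧ y₀ R = 0 ∧ y₁ R = 0 ∧
    ∀ᵐ x ∂(volume.restrict (Ioo (0 : ℝ) R)),
      z x = -y₃ x + Complex.I * (a : ℂ) * y₂ x - (b : ℂ) * y₁ x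

/-- `y ∈ H³(0, R)` and `y'(0) = d`. -/
def HasDerivTraceAtZero (R : ℝ) (y : L2Interval R) (d : ℂ) : Prop :=
  ∃ y₀ y₁ y₂ y₃ : ℝ → ℂ, IsH3Representative R y y₀ y₁ y₂ y₃ ∧ y₁ 0 = d

/-- `S` (restricted to times `t ≥ 0`) is a strongly continuous semigroup of bounded operators. -/
structure IsC0Semigroup {E : Type*} [NormedAddCommGroup E] [NormedSpace ℂ E]
    (S : ℝ → E →L[ℂ] E) : Prop where
  zero : S 0 = ContinuousLinearMap.id ℂ E
  add : ∀ s t : ℝ, 0 ≤ s → 0 ≤ t → S (s + t) = (S s).comp (S t)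
  continuousOn : ∀ x : E, ContinuousOn (fun t : ℝ => S t x) (Ici 0)

/-- The operator with graph `G` is the infinitesimal generator of `S`: `x` belongs to its
domain and is mapped to `z` if and only if `(S(t) x - x) / t → z` as `t → 0+`. -/
def IsGeneratorGraph {E : Type*} [NormedAddCommGroup E] [NormedSpace ℂ E]
    (S : ℝ → E →L[ℂ] E) (G : E → E → Prop) : Prop :=
  ∀ x z : E, G x z ↔
    Tendsto (fun t : ℝ => ((t : ℂ)⁻¹) • (S t x - x)) (𝓝[>] 0) (𝓝 z)

/-- `P : L₂(0, R) → L₂(0, T)` is the bounded boundary trace operator: `A` generates a strongly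
continuous semigroup `e^{tA}`, and for every `u₀ ∈ D(A)` the solution `u(t, ·) = e^{tA} u₀`
satisfies `(P u₀)(t) = u_x(t, 0)` for almost every `t ∈ (0, T)`. -/
def IsBoundaryTraceOperator (a b R T : ℝ) (P : L2Interval R →L[ℂ] L2Interval T) : Prop :=
  ∃ S : ℝ → L2Interval R →L[ℂ] L2Interval R,
    IsC0Semigroup S ∧ IsGeneratorGraph S (HNLSGraph a b R) ∧
    ∀ u₀ : L2Interval R, (∃ z, HNLSGraph a b R u₀ z) →
      ∀ᵐ t ∂(volume.restrict (Ioo (0 : ℝ) T)), HasDerivTraceAtZero R (S t u₀) (P u₀ t)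

/-! Integrating `2 Re (A y · ȳ)` by parts with real `a, b` leaves only the boundary term `-|y'(0)|²`
(`two_mul_re_inner_eq`). Hence `A` is dissipative. The equation `l y - A y = f` is solvable for `l >
0` by shooting (`exists_sub_eq`), so `A` generates a contraction semigroup `S`. Integrating the
dissipation along orbits gives `‖P u₀‖² = ‖u₀‖² - ‖S(T) u₀‖²` on `D(A)`. This bounds `P`, extends it
by density, and turns the observability inequality into the claim that `‖S(T) u‖ ≤ ρ ‖u‖` with some
`ρ < 1` (`exists_boundaryTrace`).

The strict contraction is a compactness and uniqueness argument
(`IsGeneratorGraph.exists_norm_le_mul`). The multiplier `x` yields Kato smoothing, an `L₂`-in-time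
bound on `u_x` (`kato_inequality`). Interpolated against the compact Volterra operator, it makes
`S(t)` compact for every `t > 0` (`exists_convergent_subseq_semigroup`). If `S(T)` were not a strict
contraction, it would preserve the norm of some nonzero vector. The spaces of vectors whose norm
`S(t)` preserves are finite-dimensional and decrease in `t`, so they are constant on some `[t, T)`.
The space at `t` is then invariant for short times, and it contains an eigenvector of `A` along
which no energy is lost.

Such an eigenfunction satisfies `y(0) = y'(0) = y(R) = y'(R) = 0`. Factoring the cubic
characteristic polynomial gives `y''(R) = e^{m R} y''(0)` for each root `m`, and `y''(0) = 0` if two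
roots coincide. A nonzero `y` therefore forces three distinct roots differing pairwise by multiples
of `2πi/R`. Vieta's formulas then say that `R` is one of the excluded lengths
(`critical_length_of_exp_eq`, `eigenfunction_eq_zero`). -/

/-! ### Calculus of absolutely continuous complex functions. -/

/-- `F` is absolutely continuous on `[0, R]` with integrable derivative `f`. -/
structure HasACDeriv (R : ℝ) (F f : ℝ → ℂ) : Prop where
  intervalIntegrable : IntervalIntegrable f volume 0 R
  isPrimitiveOn : IsPrimitiveOn R F f

theorem AbsolutelyContinuousOnInterval.congr_on_uIcc {f g : ℝ → ℂ} {a b : ℝ}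
    (hf : AbsolutelyContinuousOnInterval f a b) (h : EqOn f g (uIcc a b)) :
    AbsolutelyContinuousOnInterval g a b := by
  rw [absolutelyContinuousOnInterval_iff] at hf ⊢
  intro ε hε
  obtain ⟨δ, hδ, hf⟩ := hf ε hε
  refine ⟨δ, hδ, fun E hE hE' => ?_⟩
  rw [← Finset.sum_congr rfl fun i hi => ?_]
  · exact hf E hE hE'
  · rw [h (hE.1 i hi).1, h (hE.1 i hi).2]

/-- Real and imaginary parts are treated separately and recombined as `(∫ Re f) • 1 + (∫ Im f) • i`.
-/
theorem IntervalIntegrable.absolutelyContinuousOnInterval_integral_complex {f : ℝ → ℂ} {R : ℝ}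
    (h : IntervalIntegrable f volume 0 R) :
    AbsolutelyContinuousOnInterval (fun x => ∫ s in (0 : ℝ)..x, f s) 0 R := by
  have hc : ∀ c : ℂ, AbsolutelyContinuousOnInterval (fun _ : ℝ => c) 0 R := fun c =>
    (LipschitzWith.const c).lipschitzOnWith.absolutelyContinuousOnInterval
  have hre : IntervalIntegrable (fun x => (f x).re) volume 0 R := ⟨h.1.re, h.2.re⟩
  have him : IntervalIntegrable (fun x => (f x).im) volume 0 R := ⟨h.1.im, h.2.im⟩
  have key := ((hre.absolutelyContinuousOnInterval_intervalIntegral (c := 0) (by simp)).smul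
    (hc 1)).add ((him.absolutelyContinuousOnInterval_intervalIntegral (c := 0) (by simp)).smul
    (hc Complex.I))
  refine key.congr_on_uIcc fun x hx => ?_
  have hfx : IntervalIntegrable f volume 0 x := h.mono_set (uIcc_subset_uIcc_left hx)
  have h1 := Complex.reCLM.intervalIntegral_comp_comm hfx
  have h2 := Complex.imCLM.intervalIntegral_comp_comm hfx
  simp only [Complex.reCLM_apply, Complex.imCLM_apply] at h1 h2
  apply Complex.ext <;> simp [h1, h2]

namespace HasACDeriv

variable {R : ℝ} {F G f g : ℝ → ℂ}

theorem intervalIntegrable_sub (hF : HasACDeriv R F f) {x : ℝ} (hx : x ∈ Icc (0 : ℝ) R) :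
    IntervalIntegrable f volume 0 x :=
  hF.intervalIntegrable.mono_set (by
    rw [uIcc_of_le hx.1, uIcc_of_le (hx.1.trans hx.2)]; exact Icc_subset_Icc_right hx.2)

theorem continuousOn (hF : HasACDeriv R F f) : ContinuousOn F (Icc 0 R) := by
  rcases lt_or_ge R 0 with h | h
  · simp [Icc_eq_empty h.not_ge]
  have h1 : ContinuousOn (fun x => F 0 + ∫ s in (0 : ℝ)..x, f s) (Icc 0 R) := by
    have := intervalIntegral.continuousOn_primitive_interval
      (μ := volume) (f := f) (a := 0) (b := R) (by
        rw [uIcc_of_le h]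
        exact (intervalIntegrable_iff_integrableOn_Icc_of_le h).1 hF.intervalIntegrable)
    rw [uIcc_of_le h] at this
    exact continuousOn_const.add this
  exact h1.congr fun x hx => hF.isPrimitiveOn x hx

/-- `F - ∫ f` is absolutely continuous with derivative zero almost everywhere, hence constant. -/
theorem of_ae_hasDerivAt (hR : 0 ≤ R) (hf : IntervalIntegrable f volume 0 R)
    (hF : AbsolutelyContinuousOnInterval F 0 R)
    (hd : ∀ᵐ x, x ∈ uIcc 0 R → HasDerivAt F (f x) x) : HasACDeriv R F f := by
  refine ⟨hf, ?_⟩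
  have h1 : AbsolutelyContinuousOnInterval (fun x => F x - ∫ s in (0 : ℝ)..x, f s) 0 R :=
    hF.sub hf.absolutelyContinuousOnInterval_integral_complex
  obtain ⟨C, hC⟩ := h1.const_of_ae_hasDerivAt_zero (by
    filter_upwards [hd, hf.ae_hasDerivAt_integral] with x h2 h3 hx
    have := (h2 hx).sub (h3 hx 0 (by simp))
    rwa [sub_self] at this)
  rw [uIcc_of_le hR] at hC
  intro x hx
  have h0 := hC 0 ⟨le_rfl, hR⟩
  have hx' := hC x hx
  simp only [intervalIntegral.integral_same, sub_zero] at h0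
  rw [h0, ← hx']; ring

theorem congr_fun (hF : HasACDeriv R F f) (h : EqOn F G (Icc 0 R)) : HasACDeriv R G f := by
  refine ⟨hF.intervalIntegrable, fun x hx => ?_⟩
  rw [← h hx, ← h ⟨le_rfl, hx.1.trans hx.2⟩]; exact hF.isPrimitiveOn x hx

theorem congr_deriv (hR : 0 ≤ R) (hF : HasACDeriv R F f) (h : ∀ᵐ x ∂volume.restrict (Ioo (0:ℝ) R), f x = g x) :
    HasACDeriv R F g := by
  have h' : ∀ x ∈ Icc (0 : ℝ) R, ∀ᵐ s ∂volume.restrict (uIoc 0 x), f s = g s := fun x hx => by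
    rw [uIoc_of_le hx.1, ← restrict_Ioo_eq_restrict_Ioc]
    exact ae_restrict_of_ae_restrict_of_subset (Ioo_subset_Ioo_right hx.2) h
  refine ⟨hF.intervalIntegrable.congr_ae (h' R ⟨hR, le_rfl⟩), fun x hx => ?_⟩
  rw [hF.isPrimitiveOn x hx, intervalIntegral.integral_congr_ae_restrict (h' x hx)]

theorem mul (hR : 0 ≤ R) (hF : HasACDeriv R F f) (hG : HasACDeriv R G g) :
    HasACDeriv R (fun x => F x * G x) (fun x => f x * G x + F x * g x) := by
  -- The values of `F` and `G` outside `[0, R]` are arbitrary, so two-sided derivatives are taken of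
  -- the integral formulas instead.
  set F' : ℝ → ℂ := fun x => F 0 + ∫ s in (0 : ℝ)..x, f s with hF'
  set G' : ℝ → ℂ := fun x => G 0 + ∫ s in (0 : ℝ)..x, g s with hG'
  have eF : EqOn F F' (Icc 0 R) := hF.isPrimitiveOn
  have eG : EqOn G G' (Icc 0 R) := hG.isPrimitiveOn
  have hc : ∀ c : ℂ, AbsolutelyContinuousOnInterval (fun _ : ℝ => c) 0 R := fun c =>
    (LipschitzWith.const c).lipschitzOnWith.absolutelyContinuousOnInterval
  have aF : AbsolutelyContinuousOnInterval F' 0 R :=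
    (hc _).add hF.intervalIntegrable.absolutelyContinuousOnInterval_integral_complex
  have aG : AbsolutelyContinuousOnInterval G' 0 R :=
    (hc _).add hG.intervalIntegrable.absolutelyContinuousOnInterval_integral_complex
  have hint : IntervalIntegrable (fun x => f x * G x + F x * g x) volume 0 R := by
    have cF := hF.continuousOn
    have cG := hG.continuousOn
    rw [← uIcc_of_le hR] at cF cG
    exact (hF.intervalIntegrable.mul_continuousOn cG).add
      (hG.intervalIntegrable.continuousOn_mul cF)
  have := of_ae_hasDerivAt (F := fun x => F' x * G' x) hR hint (aF.smul aG) (by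
    filter_upwards [hF.intervalIntegrable.ae_hasDerivAt_integral,
      hG.intervalIntegrable.ae_hasDerivAt_integral] with x h1 h2 hx
    have := ((h1 hx 0 (by simp)).const_add (F 0)).mul ((h2 hx 0 (by simp)).const_add (G 0))
    rw [uIcc_of_le hR] at hx
    rw [eF hx, eG hx]
    exact this)
  exact this.congr_fun fun x hx => by simp only [eF hx, eG hx]

theorem add (hF : HasACDeriv R F f) (hG : HasACDeriv R G g) :
    HasACDeriv R (fun x => F x + G x) (fun x => f x + g x) := by
  refine ⟨hF.intervalIntegrable.add hG.intervalIntegrable, fun x hx => ?_⟩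
  rw [intervalIntegral.integral_add (hF.intervalIntegrable_sub hx) (hG.intervalIntegrable_sub hx),
    hF.isPrimitiveOn x hx, hG.isPrimitiveOn x hx]
  ring

theorem const_mul (c : ℂ) (hF : HasACDeriv R F f) :
    HasACDeriv R (fun x => c * F x) (fun x => c * f x) := by
  refine ⟨hF.intervalIntegrable.const_mul c, fun x hx => ?_⟩
  rw [intervalIntegral.integral_const_mul, hF.isPrimitiveOn x hx]
  ring

theorem neg (hF : HasACDeriv R F f) : HasACDeriv R (fun x => -F x) (fun x => -f x) := by
  simpa using hF.const_mul (-1)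

theorem sub (hF : HasACDeriv R F f) (hG : HasACDeriv R G g) :
    HasACDeriv R (fun x => F x - G x) (fun x => f x - g x) := by
  simpa [sub_eq_add_neg] using hF.add hG.neg

theorem conj (hF : HasACDeriv R F f) :
    HasACDeriv R (fun x => (starRingEnd ℂ) (F x)) (fun x => (starRingEnd ℂ) (f x)) := by
  refine ⟨?_, fun x hx => ?_⟩
  · exact ⟨(Complex.conjCLE.toContinuousLinearMap.integrable_comp hF.intervalIntegrable.1),
      (Complex.conjCLE.toContinuousLinearMap.integrable_comp hF.intervalIntegrable.2)⟩
  · rw [hF.isPrimitiveOn x hx, map_add]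
    congr 1
    exact (Complex.conjCLE.toContinuousLinearMap.intervalIntegral_comp_comm
      (hF.intervalIntegrable_sub hx)).symm

theorem of_hasDerivAt (hF : ∀ x, HasDerivAt F (f x) x) (hf : Continuous f) :
    HasACDeriv R F f := by
  refine ⟨hf.intervalIntegrable _ _, fun x _ => ?_⟩
  rw [intervalIntegral.integral_eq_sub_of_hasDerivAt (fun y _ => hF y)
    (hf.intervalIntegrable _ _)]
  ring

theorem integral_eq (hR : 0 ≤ R) (hF : HasACDeriv R F f) :
    ∫ x in (0 : ℝ)..R, f x = F R - F 0 := by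
  rw [hF.isPrimitiveOn R ⟨hR, le_rfl⟩]; ring

theorem of_continuousOn (hR : 0 ≤ R) (hf : ContinuousOn f (Icc 0 R)) (h : IsPrimitiveOn R F f) :
    HasACDeriv R F f :=
  ⟨ContinuousOn.intervalIntegrable (by rwa [uIcc_of_le hR]), h⟩

/-- If an absolutely continuous function vanishes, so does its derivative. -/
theorem deriv_ae_zero (hR : 0 ≤ R) (hF : HasACDeriv R F f) (h0 : ∀ x ∈ Icc (0 : ℝ) R, F x = 0) :
    ∀ᵐ x ∂volume.restrict (Ioo (0 : ℝ) R), f x = 0 := by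
  rw [ae_restrict_iff' measurableSet_Ioo]
  filter_upwards [hF.intervalIntegrable.ae_hasDerivAt_integral] with x h1 hx
  have hx' : x ∈ uIcc 0 R := by rw [uIcc_of_le hR]; exact Ioo_subset_Icc_self hx
  have h2 := h1 hx' 0 (by simp)
  refine h2.unique ((hasDerivAt_const x (0 : ℂ)).congr_of_eventuallyEq ?_)
  filter_upwards [Ioo_mem_nhds hx.1 hx.2] with y hy
  have h3 := hF.isPrimitiveOn y (Ioo_subset_Icc_self hy)
  rw [h0 y (Ioo_subset_Icc_self hy), h0 0 ⟨le_rfl, hR⟩] at h3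
  simpa using h3.symm

theorem deriv_zero_of_continuousOn (hR : 0 < R) (hF : HasACDeriv R F f)
    (hf : ContinuousOn f (Icc 0 R)) (h0 : ∀ x ∈ Icc (0 : ℝ) R, F x = 0) :
    ∀ x ∈ Icc (0 : ℝ) R, f x = 0 := by
  have h1 := hF.deriv_ae_zero hR.le h0
  rw [Measure.restrict_congr_set (Ioo_ae_eq_Icc (μ := volume))] at h1
  exact Measure.eqOn_Icc_of_ae_eq volume hR.ne h1 hf continuousOn_const

end HasACDeriv

theorem eq_sub_of_sub_eq' {α : Type*} [AddCommGroup α] {a b c : α} (h : a - b = c) :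
    b = a - c := by
  rw [← h]; abel

/-! ### Flows of bounded dissipative operators. -/

section BoundedGenerator

variable {H : Type*} [NormedAddCommGroup H] [InnerProductSpace ℂ H]

theorem hasDerivWithinAt_re_inner {u v : ℝ → H} {u' v' : H} {s : Set ℝ} {t : ℝ}
    (hu : HasDerivWithinAt u u' s t) (hv : HasDerivWithinAt v v' s t) :
    HasDerivWithinAt (fun r => (inner ℂ (u r) (v r)).re)
      ((inner ℂ (u t) v').re + (inner ℂ u' (v t)).re) s t := by
  have := Complex.reCLM.hasFDerivAt.comp_hasDerivWithinAt t (hu.inner ℂ hv)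
  rw [Complex.reCLM_apply, Complex.add_re] at this
  exact this

theorem hasDerivWithinAt_norm_sq_complex {u : ℝ → H} {u' : H} {s : Set ℝ} {t : ℝ}
    (hu : HasDerivWithinAt u u' s t) :
    HasDerivWithinAt (fun r => ‖u r‖ ^ 2) (2 * (inner ℂ u' (u t)).re) s t := by
  have h := hasDerivWithinAt_re_inner hu hu
  have e : (inner ℂ (u t) u').re = (inner ℂ u' (u t)).re := inner_re_symm (𝕜 := ℂ) _ _
  rw [e, ← two_mul] at h
  convert h using 2 with r
  exact (inner_self_eq_norm_sq (𝕜 := ℂ) (u r)).symm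

/-- A function with `Re ⟨u', u⟩ ≤ 0` has nonincreasing norm. -/
theorem norm_le_of_re_inner_nonpos {u u' : ℝ → H} {T : ℝ} (hT : 0 ≤ T)
    (hc : ContinuousOn u (Icc 0 T))
    (hu : ∀ t ∈ Ico (0 : ℝ) T, HasDerivWithinAt u (u' t) (Ici t) t)
    (hd : ∀ t ∈ Ico (0 : ℝ) T, (inner ℂ (u' t) (u t)).re ≤ 0) : ‖u T‖ ≤ ‖u 0‖ := by
  have := image_le_of_deriv_right_le_deriv_boundary (f := fun t => ‖u t‖ ^ 2)
    (f' := fun t => 2 * (inner ℂ (u' t) (u t)).re) (a := 0) (b := T)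
    (B := fun _ => ‖u 0‖ ^ 2) (B' := fun _ => 0) (hc.norm.pow 2)
    (fun t ht => hasDerivWithinAt_norm_sq_complex (hu t ht)) le_rfl continuousOn_const
    (fun t _ => hasDerivWithinAt_const _ _ _) (fun t ht => by linarith [hd t ht])
    (x := T) ⟨hT, le_rfl⟩
  exact (sq_le_sq₀ (norm_nonneg _) (norm_nonneg _)).1 this

variable [CompleteSpace H]

/-- The norm-continuous group `e^{tB}` generated by a bounded operator. -/
noncomputable def expFlow (B : H →L[ℂ] H) (t : ℝ) : H →L[ℂ] H := NormedSpace.exp ((t : ℂ) • B)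

theorem expFlow_zero (B : H →L[ℂ] H) : expFlow B 0 = 1 := by
  simp [expFlow]

theorem expFlow_add (B : H →L[ℂ] H) (s t : ℝ) :
    expFlow B (s + t) = expFlow B s * expFlow B t := by
  have : NormedAlgebra ℚ (H →L[ℂ] H) := NormedAlgebra.restrictScalars ℚ ℂ _
  rw [expFlow, Complex.ofReal_add, add_smul, NormedSpace.exp_add_of_commute]
  · rfl
  · exact ((Commute.refl B).smul_left _).smul_right _

theorem commute_expFlow {B C : H →L[ℂ] H} (h : Commute B C) (t : ℝ) :
    Commute B (expFlow C t) := by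
  exact (h.smul_right _).exp_right

theorem hasDerivAt_expFlow (B : H →L[ℂ] H) (x : H) (t : ℝ) :
    HasDerivAt (fun s => expFlow B s x) (expFlow B t (B x)) t := by
  have h1 := hasDerivAt_exp_smul_const (𝕂 := ℂ) B (t : ℂ)
  have h2 : HasDerivAt (fun u : ℂ => NormedSpace.exp (u • B) x)
      ((NormedSpace.exp ((t : ℂ) • B) * B) x) (t : ℂ) := by
    simpa using h1.clm_apply (hasDerivAt_const (t : ℂ) x)
  have h3 := h2.scomp_of_eq (𝕜 := ℝ) t Complex.ofRealCLM.hasDerivAt (by simp)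
  simpa [expFlow, Function.comp_def] using h3

/-- `B` commutes with its own flow, so the derivative of `‖e^{sB} x‖²` is `2 Re ⟨B u, u⟩ ≤ 0` at `u
= e^{sB} x`. -/
theorem norm_expFlow_apply_le {B : H →L[ℂ] H} (hB : ∀ x, (inner ℂ (B x) x).re ≤ 0) {t : ℝ}
    (ht : 0 ≤ t) (x : H) : ‖expFlow B t x‖ ≤ ‖x‖ := by
  have hd := hasDerivAt_expFlow B x
  have hcomm : ∀ s, expFlow B s (B x) = B (expFlow B s x) := fun s =>
    (DFunLike.congr_fun (commute_expFlow (Commute.refl B) s).eq x).symm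
  have := norm_le_of_re_inner_nonpos (u := fun s => expFlow B s x) ht
    (fun s _ => (hd s).continuousAt.continuousWithinAt) (fun s _ => (hd s).hasDerivWithinAt)
    (fun s _ => by rw [hcomm]; exact hB _)
  simpa [expFlow_zero] using this

/-- The path `s ↦ e^{(t-s)C} e^{sB} x` joins the two flows. Its derivative `e^{(t-s)C} e^{sB} (B -
C) x` is a product of contractions applied to `(B - C) x`. -/
theorem norm_expFlow_sub_le {B C : H →L[ℂ] H} (hB : ∀ x, (inner ℂ (B x) x).re ≤ 0)
    (hC : ∀ x, (inner ℂ (C x) x).re ≤ 0) (hBC : Commute B C) {t : ℝ} (ht : 0 ≤ t) (x : H) :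
    ‖expFlow B t x - expFlow C t x‖ ≤ t * ‖B x - C x‖ := by
  have : NormedAlgebra ℚ (H →L[ℂ] H) := NormedAlgebra.restrictScalars ℚ ℂ _
  have key : ∀ s, expFlow C t * expFlow (B - C) s = expFlow C (t - s) * expFlow B s := by
    intro s
    have c1 : Commute ((t : ℂ) • C) ((s : ℂ) • (B - C)) :=
      ((hBC.symm.sub_right (Commute.refl C)).smul_right _).smul_left _
    have c2 : Commute (((t - s : ℝ) : ℂ) • C) ((s : ℂ) • B) :=
      (hBC.symm.smul_right _).smul_left _
    rw [expFlow, expFlow, expFlow, expFlow, ← NormedSpace.exp_add_of_commute c1,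
      ← NormedSpace.exp_add_of_commute c2]
    congr 1
    push_cast
    module
  have hd : ∀ s, HasDerivAt (fun s => (expFlow C t * expFlow (B - C) s) x)
      ((expFlow C (t - s) * expFlow B s) (B x - C x)) s := by
    intro s
    rw [← key]
    exact ((expFlow C t).restrictScalars ℝ).hasFDerivAt.comp_hasDerivAt s
      (hasDerivAt_expFlow (B - C) x s)
  have := norm_image_sub_le_of_norm_deriv_le_segment' (a := 0) (b := t) (C := ‖B x - C x‖)
    (fun s _ => (hd s).hasDerivWithinAt) (fun s hs => by
      exact (norm_expFlow_apply_le hC (sub_nonneg.2 hs.2.le) _).trans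
        (norm_expFlow_apply_le hB hs.1 _)) t ⟨ht, le_rfl⟩
  rw [key t, key 0] at this
  simpa [expFlow_zero, mul_comm] using this

end BoundedGenerator

/-! ### Maximal dissipative operators and generation of semigroups. -/

/-- A linear maximal dissipative operator in a Hilbert space, given by its graph. -/
structure IsMaximalDissipative {H : Type*} [NormedAddCommGroup H] [InnerProductSpace ℂ H]
    (G : Submodule ℂ (H × H)) : Prop where
  dissipative : ∀ x y, (x, y) ∈ G → (inner ℂ y x).re ≤ 0
  surjective : ∀ l : ℝ, 0 < l → ∀ f, ∃ x y, (x, y) ∈ G ∧ (l : ℂ) • x - y = f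
  single_valued : ∀ y, ((0 : H), y) ∈ G → y = 0

namespace IsMaximalDissipative

variable {H : Type*} [NormedAddCommGroup H] [InnerProductSpace ℂ H]
  {G : Submodule ℂ (H × H)}

/-- Pairing `l x - y` with `x` gives at least `l ‖x‖²` in real part; Cauchy–Schwarz does the rest.
-/
theorem norm_le (hG : IsMaximalDissipative G) (l : ℝ) {x y : H} (h : (x, y) ∈ G) :
    l * ‖x‖ ≤ ‖(l : ℂ) • x - y‖ := by
  rcases (norm_nonneg x).eq_or_lt with h0 | h0
  · rw [← h0]; simp
  have h1 : (inner ℂ ((l : ℂ) • x - y) x).re ≤ ‖(l : ℂ) • x - y‖ * ‖x‖ :=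
    re_inner_le_norm (𝕜 := ℂ) _ _
  have h2 : (inner ℂ ((l : ℂ) • x - y) x).re = l * ‖x‖ ^ 2 - (inner ℂ y x).re := by
    rw [inner_sub_left, inner_smul_left, inner_self_eq_norm_sq_to_K]
    simp [← Complex.ofReal_pow]
  have h3 := hG.dissipative x y h
  have : (l * ‖x‖) * ‖x‖ ≤ ‖(l : ℂ) • x - y‖ * ‖x‖ := by nlinarith
  exact le_of_mul_le_mul_right this h0

theorem eq_of_mem (hG : IsMaximalDissipative G) {x y z : H} (h : (x, y) ∈ G) (h' : (x, z) ∈ G) :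
    y = z := by
  have := G.sub_mem h h'
  simp only [Prod.mk_sub_mk, sub_self] at this
  exact sub_eq_zero.1 (hG.single_valued _ this)

/-- The resolvent `(l - A)⁻¹`. -/
theorem exists_resolvent (hG : IsMaximalDissipative G) {l : ℝ} (hl : 0 < l) :
    ∃ J : H →L[ℂ] H, (∀ f, (J f, (l : ℂ) • J f - f) ∈ G) ∧
      (∀ x y, (x, y) ∈ G → J ((l : ℂ) • x - y) = x) ∧ ∀ f, l * ‖J f‖ ≤ ‖f‖ := by
  have uniq : ∀ x y x' y', (x, y) ∈ G → (x', y') ∈ G → (l : ℂ) • x - y = (l : ℂ) • x' - y' →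
      x = x' := by
    intro x y x' y' h h' e
    have h1 := hG.norm_le l (x := x - x') (y := y - y') (G.sub_mem h h')
    have : (l : ℂ) • (x - x') - (y - y') = 0 := by
      rw [smul_sub, ← sub_eq_zero.2 e]; abel
    rw [this, norm_zero] at h1
    have : ‖x - x'‖ ≤ 0 := by
      by_contra hc
      push Not at hc
      nlinarith
    exact sub_eq_zero.1 (norm_le_zero_iff.1 this)
  choose X Y hXY hf using hG.surjective l hl
  have hY : ∀ f, Y f = (l : ℂ) • X f - f := fun f => eq_sub_of_sub_eq' (hf f)
  let J₀ : H →ₗ[ℂ] H :=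
    { toFun := X
      map_add' := fun f g => uniq _ _ _ _ (hXY _) (G.add_mem (hXY f) (hXY g)) (by
        rw [hf]
        nth_rewrite 1 [← hf f, ← hf g]
        simp only [smul_add]
        abel)
      map_smul' := fun c f => uniq _ _ _ _ (hXY _) (G.smul_mem c (hXY f)) (by
        rw [hf]
        nth_rewrite 1 [← hf f]
        simp only [RingHom.id_apply]
        module) }
  have hJ : ∀ f, l * ‖X f‖ ≤ ‖f‖ := fun f => by
    have := hG.norm_le l (hXY f)
    rwa [hf] at this
  refine ⟨J₀.mkContinuous l⁻¹ fun f => ?_, fun f => ?_, fun x y h => ?_, hJ⟩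
  · rw [inv_mul_eq_div, le_div_iff₀ hl, mul_comm]; exact hJ f
  · have := hXY f
    rwa [hY] at this
  · exact uniq _ _ _ _ (hXY _) h (hf _)

/-- If `f = x - y`, with `(x, y)` in the graph, is orthogonal to the domain, then `⟨x, x - y⟩ = 0`
gives `‖x‖² = Re ⟨y, x⟩ ≤ 0`. So `x = 0`, and `y = 0` by single-valuedness. -/
theorem dense (hG : IsMaximalDissipative G) [CompleteSpace H] : Dense {x : H | ∃ y, (x, y) ∈ G} := by
  let D : Submodule ℂ H := G.map (LinearMap.fst ℂ H H)
  have hD : (D : Set H) = {x : H | ∃ y, (x, y) ∈ G} := by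
    ext x; simp [D]
  rw [← hD, Submodule.dense_iff_topologicalClosure_eq_top, Submodule.topologicalClosure_eq_top_iff,
    Submodule.eq_bot_iff]
  intro f hf
  obtain ⟨x, y, h, rfl⟩ := hG.surjective 1 one_pos f
  have h1 := (Submodule.mem_orthogonal _ _).1 hf x (by simp only [D, Submodule.mem_map]; exact ⟨(x, y), h, rfl⟩)
  have h2 := hG.dissipative x y h
  have h3 : (inner ℂ x y).re = (inner ℂ y x).re := inner_re_symm (𝕜 := ℂ) _ _
  rw [inner_sub_right, Complex.ofReal_one, one_smul] at h1
  have h4 := congrArg Complex.re h1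
  have h5 : (inner ℂ x x).re = ‖x‖ ^ 2 := inner_self_eq_norm_sq (𝕜 := ℂ) x
  rw [Complex.sub_re, h3, h5] at h4
  have h6 : x = 0 := by
    have : ‖x‖ ^ 2 ≤ 0 := by simp at h4; linarith
    simpa using this.antisymm (by positivity)
  subst h6
  simp [hG.single_valued y h]

end IsMaximalDissipative

namespace IsMaximalDissipative

variable {H : Type*} [NormedAddCommGroup H] [InnerProductSpace ℂ H] [CompleteSpace H]
  {G : Submodule ℂ (H × H)}

/-- The Yosida approximations of a maximal dissipative operator. -/
theorem exists_yosida (hG : IsMaximalDissipative G) :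
    ∃ B : ℕ → H →L[ℂ] H, (∀ k x, (inner ℂ (B k x) x).re ≤ 0) ∧ (∀ k m, Commute (B k) (B m)) ∧
      ∀ x y, (x, y) ∈ G → Tendsto (fun k => B k x) atTop (𝓝 y) := by
  have hl : ∀ k : ℕ, (0 : ℝ) < k + 1 := fun k => by positivity
  choose J hJ1 hJ2 hJ3 using fun k : ℕ => hG.exists_resolvent (hl k)
  have hJ4 : ∀ k f, ‖J k f‖ ≤ ‖f‖ / (k + 1) := fun k f => by
    rw [le_div_iff₀ (hl k), mul_comm]; exact hJ3 k f
  have hJG : ∀ k x y, (x, y) ∈ G → J k y = (((k : ℝ) + 1 : ℝ) : ℂ) • J k x - x := fun k x y h => by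
    have := hJ2 k x y h
    rw [map_sub, map_smul] at this
    exact eq_sub_of_sub_eq' this
  -- Evaluating each resolvent on the graph pair produced by the other and subtracting gives `(k -
  -- m)` times the commutator equal to zero.
  have hcomm : ∀ k m, Commute (J k) (J m) := by
    intro k m
    rcases eq_or_ne k m with rfl | hkm
    · exact Commute.refl _
    ext f
    have h1 := hJG k _ _ (hJ1 m f)
    have h2 := hJG m _ _ (hJ1 k f)
    simp only [map_sub, map_smul] at h1 h2
    have h3 : ((k : ℂ) - m) • (J k (J m f) - J m (J k f)) = 0 := by
      have e : (((k : ℝ) + 1 : ℝ) : ℂ) • J k (J m f) - J m f -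
        ((((m : ℝ) + 1 : ℝ) : ℂ) • J k (J m f) - J k f) = 0 := by rw [← h1]; abel
      have e' : (((m : ℝ) + 1 : ℝ) : ℂ) • J m (J k f) - J k f -
        ((((k : ℝ) + 1 : ℝ) : ℂ) • J m (J k f) - J m f) = 0 := by rw [← h2]; abel
      rw [← add_zero (0 : H)]
      nth_rewrite 1 [← e]
      rw [← e']
      push_cast
      module
    have h4 : (k : ℂ) - m ≠ 0 := sub_ne_zero.2 (by exact_mod_cast hkm)
    exact sub_eq_zero.1 ((smul_eq_zero.1 h3).resolve_left h4)
  -- On the domain the error is `J k z`, of size `‖z‖ / (k + 1)`; density and `‖(k + 1) J k‖ ≤ 1`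
  -- cover the rest.
  have hJid : ∀ y, Tendsto (fun k : ℕ => (((k : ℝ) + 1 : ℝ) : ℂ) • J k y) atTop (𝓝 y) := by
    intro y
    rw [Metric.tendsto_atTop]
    intro ε hε
    obtain ⟨x, hx, z, hxy⟩ := Metric.dense_iff.1 hG.dense y (ε / 4) (by positivity)
    rw [Metric.mem_ball, dist_comm, dist_eq_norm] at hx
    obtain ⟨N, hN⟩ := exists_nat_gt (‖z‖ / (ε / 4))
    refine ⟨N, fun k hk => ?_⟩
    have hN' : ‖z‖ / (k + 1) < ε / 4 := by
      rw [div_lt_iff₀ (by positivity)] at hN ⊢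
      have : (N : ℝ) ≤ k := by exact_mod_cast hk
      nlinarith
    have h1 : ‖J k z‖ ≤ ‖z‖ / (k + 1) := hJ4 k z
    have h2 := hJ3 k (y - x)
    have e : (((k : ℝ) + 1 : ℝ) : ℂ) • J k y - y =
        (((k : ℝ) + 1 : ℝ) : ℂ) • J k (y - x) - (y - x) + J k z := by
      rw [hJG k x z hxy, map_sub, smul_sub]; abel
    rw [dist_eq_norm, e]
    have h3 := norm_add_le ((((k : ℝ) + 1 : ℝ) : ℂ) • J k (y - x) - (y - x)) (J k z)
    have h4 := norm_sub_le ((((k : ℝ) + 1 : ℝ) : ℂ) • J k (y - x)) (y - x)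
    rw [norm_smul, Complex.norm_real, Real.norm_of_nonneg (hl k).le] at h4
    linarith
  -- With `l = k + 1`, this is `l (l J - 1) = l A J`, equal to `l J A` on the domain, hence
  -- convergent to `A` there.
  refine ⟨fun k => (((k : ℝ) + 1 : ℝ) : ℂ) • ((((k : ℝ) + 1 : ℝ) : ℂ) • J k - 1), fun k x => ?_,
    fun k m => ?_, fun x y h => ?_⟩
  · set l : ℝ := (k : ℝ) + 1
    have hd := hG.dissipative _ _ (hJ1 k x)
    set z : H := (l : ℂ) • J k x - x with hz
    have hx : x = (l : ℂ) • J k x - z := by rw [hz]; abel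
    -- Substituting `x = l J x - z` gives `Re ⟨z, x⟩ = l Re ⟨z, J x⟩ - ‖z‖²`, where `z = A J x`.
    have h1 : (inner ℂ z x).re ≤ 0 := by
      rw [hx, inner_sub_right, inner_smul_right, inner_self_eq_norm_sq_to_K, Complex.sub_re,
        Complex.re_ofReal_mul]
      have h2 : (((‖z‖ : ℂ)) ^ 2).re = ‖z‖ ^ 2 := by rw [← Complex.ofReal_pow, Complex.ofReal_re]
      have h3 : l * (inner ℂ z (J k x)).re ≤ 0 := mul_nonpos_of_nonneg_of_nonpos (hl k).le hd
      simp only [Complex.coe_algebraMap, h2]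
      linarith [sq_nonneg ‖z‖]
    have h2 : ((l : ℂ) • ((l : ℂ) • J k - 1)) x = (l : ℂ) • z := by simp [hz]
    rw [h2, inner_smul_left, Complex.conj_ofReal, Complex.re_ofReal_mul]
    exact mul_nonpos_of_nonneg_of_nonpos (hl k).le h1
  · refine Commute.smul_left (Commute.smul_right ?_ _) _
    exact ((((hcomm k m).smul_left _).smul_right _).sub_left (Commute.one_left _)).sub_right
      (Commute.one_right _)
  · refine (hJid y).congr fun k => ?_
    rw [hJG k x y h]
    simp

/-- The **Lumer–Phillips theorem** in a Hilbert space: a maximal dissipative operator generates a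
strongly continuous contraction semigroup. -/
theorem exists_semigroup (hG : IsMaximalDissipative G) :
    ∃ S : ℝ → H →L[ℂ] H, IsC0Semigroup S ∧ IsGeneratorGraph S (fun x y => (x, y) ∈ G) ∧
      ∀ t, 0 ≤ t → ∀ x, ‖S t x‖ ≤ ‖x‖ := by
  obtain ⟨B, hB, hcomm, hlim⟩ := hG.exists_yosida
  have hE : ∀ k t, 0 ≤ t → ∀ x, ‖expFlow (B k) t x‖ ≤ ‖x‖ := fun k t ht x =>
    norm_expFlow_apply_le (hB k) ht x
  have hcau : ∀ t, 0 ≤ t → ∀ x, CauchySeq fun k => expFlow (B k) t x := by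
    intro t ht x
    rw [Metric.cauchySeq_iff]
    intro ε hε
    obtain ⟨x', hx, y, hxy⟩ := Metric.dense_iff.1 hG.dense x (ε / 4) (by positivity)
    rw [Metric.mem_ball, dist_comm, dist_eq_norm] at hx
    obtain ⟨N, hN⟩ := Metric.cauchySeq_iff.1 (hlim x' y hxy).cauchySeq (ε / (4 * (t + 1)))
      (by positivity)
    refine ⟨N, fun m hm n hn => ?_⟩
    have h1 := hN m hm n hn
    rw [dist_eq_norm, lt_div_iff₀ (by positivity)] at h1
    have h2 := norm_expFlow_sub_le (hB m) (hB n) (hcomm m n) ht x'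
    have h3 := hE m t ht (x - x')
    have h4 := hE n t ht (x - x')
    rw [dist_eq_norm]
    have e : expFlow (B m) t x - expFlow (B n) t x = expFlow (B m) t (x - x') -
      expFlow (B n) t (x - x') + (expFlow (B m) t x' - expFlow (B n) t x') := by
      simp only [map_sub]; abel
    rw [e]
    have h5 := norm_add_le (expFlow (B m) t (x - x') - expFlow (B n) t (x - x'))
      (expFlow (B m) t x' - expFlow (B n) t x')
    have h6 := norm_sub_le (expFlow (B m) t (x - x')) (expFlow (B n) t (x - x'))
    nlinarith [norm_nonneg (B m x' - B n x')]
  choose L hL using fun t ht x => cauchySeq_tendsto_of_complete (hcau t ht x)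
  -- The value `0` at negative times is never used.
  let S : ℝ → H →L[ℂ] H := fun t => if ht : 0 ≤ t then
    continuousLinearMapOfTendsto (l := atTop) (fun k => expFlow (B k) t) (f := L t ht)
      (tendsto_pi_nhds.2 (hL t ht)) else 0
  have hS : ∀ t, 0 ≤ t → ∀ x, Tendsto (fun k => expFlow (B k) t x) atTop (𝓝 (S t x)) := by
    intro t ht x
    simp only [S, dif_pos ht]
    exact hL t ht x
  have hcon : ∀ t, 0 ≤ t → ∀ x, ‖S t x‖ ≤ ‖x‖ := fun t ht x =>
    le_of_tendsto (hS t ht x).norm (Eventually.of_forall fun k => hE k t ht x)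
  have hlip' : ∀ k t, 0 ≤ t → ∀ x, ‖expFlow (B k) t x - x‖ ≤ t * ‖B k x‖ := by
    intro k t ht x
    have := norm_expFlow_sub_le (hB k) (C := 0) (by simp) (Commute.zero_right _) ht x
    simpa [expFlow] using this
  have hlip : ∀ x y, (x, y) ∈ G → ∀ t, 0 ≤ t → ‖S t x - x‖ ≤ t * ‖y‖ := fun x y h t ht =>
    le_of_tendsto_of_tendsto ((hS t ht x).sub_const x).norm ((hlim x y h).norm.const_mul t)
      (Eventually.of_forall fun k => hlip' k t ht x)
  -- Quantitative differentiability at `0`. Since `y = A x` need not lie in the domain, it is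
  -- approximated by `x₂` in the domain, where `S(s) x₂ - x₂` is at most `s ‖y₂‖`.
  have hder : ∀ x y, (x, y) ∈ G → ∀ x₂ y₂, (x₂, y₂) ∈ G → ∀ t, 0 ≤ t →
      ‖S t x - x - (t : ℂ) • y‖ ≤ (2 * ‖y - x₂‖ + t * ‖y₂‖) * t := by
    intro x y h x₂ y₂ h₂ t ht
    have h1 : Tendsto (fun k => (‖B k x - y‖ + 2 * ‖y - x₂‖ + t * ‖B k x₂‖) * t) atTop
        (𝓝 ((‖y - y‖ + 2 * ‖y - x₂‖ + t * ‖y₂‖) * t)) :=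
      (((((hlim x y h).sub_const y).norm.add_const _).add
        ((hlim x₂ y₂ h₂).norm.const_mul t)).mul_const t)
    rw [sub_self, norm_zero, zero_add] at h1
    refine le_of_tendsto_of_tendsto (((hS t ht x).sub_const x).sub_const ((t : ℂ) • y)).norm h1
      (Eventually.of_forall fun k => ?_)
    have hd : ∀ s, HasDerivAt (fun s : ℝ => expFlow (B k) s x - s • y)
        (expFlow (B k) s (B k x) - (1 : ℝ) • y) s := fun s =>
      (hasDerivAt_expFlow (B k) x s).sub ((hasDerivAt_id s).smul_const y)
    have := norm_image_sub_le_of_norm_deriv_le_segment' (a := 0) (b := t)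
      (C := ‖B k x - y‖ + 2 * ‖y - x₂‖ + t * ‖B k x₂‖)
      (fun s _ => (hd s).hasDerivWithinAt) (fun s hs => by
        have e : expFlow (B k) s (B k x) - (1 : ℝ) • y = expFlow (B k) s (B k x - y) +
          (expFlow (B k) s (y - x₂) - (y - x₂)) + (expFlow (B k) s x₂ - x₂) := by
          simp only [map_sub, one_smul]; abel
        rw [e]
        have e1 := hE k s hs.1 (B k x - y)
        have e2 := hE k s hs.1 (y - x₂)
        have e3 := hlip' k s hs.1 x₂
        have e4 : s * ‖B k x₂‖ ≤ t * ‖B k x₂‖ :=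
          mul_le_mul_of_nonneg_right hs.2.le (norm_nonneg _)
        refine (norm_add_le _ _).trans (add_le_add ((norm_add_le _ _).trans
          (add_le_add e1 ?_)) (e3.trans e4))
        exact (norm_sub_le _ _).trans (by linarith)) t ⟨ht, le_rfl⟩
    simp only [expFlow_zero, one_apply_eq_self, zero_smul, sub_zero] at this
    rw [sub_right_comm] at this
    simpa only [Complex.coe_smul] using this
  have hzero : S 0 = ContinuousLinearMap.id ℂ H := by
    ext x
    refine tendsto_nhds_unique (hS 0 le_rfl x) ?_
    simp [expFlow_zero]
  have hadd : ∀ s t : ℝ, 0 ≤ s → 0 ≤ t → S (s + t) = (S s).comp (S t) := by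
    intro s t hs ht
    ext x
    refine tendsto_nhds_unique (hS _ (add_nonneg hs ht) x) ?_
    rw [tendsto_iff_norm_sub_tendsto_zero]
    have h1 := ((hS t ht x).sub_const (S t x)).norm.add
      ((hS s hs (S t x)).sub_const (S s (S t x))).norm
    rw [sub_self, sub_self, norm_zero, add_zero] at h1
    refine squeeze_zero (fun _ => norm_nonneg _) (fun k => ?_) h1
    have e : expFlow (B k) (s + t) x - (S s).comp (S t) x =
      expFlow (B k) s (expFlow (B k) t x - S t x) +
        (expFlow (B k) s (S t x) - S s (S t x)) := by
      rw [expFlow_add]; simp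
    rw [e]
    exact (norm_add_le _ _).trans (add_le_add_left (hE k s hs _) _)
  have hcont0 : ∀ x, ∀ ε > 0, ∃ δ > 0, ∀ t, 0 ≤ t → t < δ → ‖S t x - x‖ < ε := by
    intro x ε hε
    obtain ⟨x', hx, y, hxy⟩ := Metric.dense_iff.1 hG.dense x (ε / 4) (by positivity)
    rw [Metric.mem_ball, dist_comm, dist_eq_norm] at hx
    refine ⟨ε / (4 * (‖y‖ + 1)), by positivity, fun t ht htδ => ?_⟩
    rw [lt_div_iff₀ (by positivity)] at htδ
    have h1 := hlip x' y hxy t ht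
    have h2 := hcon t ht (x - x')
    have e : S t x - x = S t (x - x') - (x - x') + (S t x' - x') := by
      simp only [map_sub]; abel
    rw [e]
    have h5 := norm_add_le (S t (x - x') - (x - x')) (S t x' - x')
    have h6 := norm_sub_le (S t (x - x')) (x - x')
    nlinarith
  have hcont1 : ∀ x s t, 0 ≤ s → s ≤ t → ‖S t x - S s x‖ ≤ ‖S (t - s) x - x‖ := by
    intro x s t hs hst
    have : S t x = S s (S (t - s) x) := by
      rw [← ContinuousLinearMap.comp_apply, ← hadd s (t - s) hs (sub_nonneg.2 hst)]
      congr 2; ring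
    rw [this, ← map_sub]
    exact hcon s hs _
  have hfwd : ∀ x z, (x, z) ∈ G →
      Tendsto (fun t : ℝ => ((t : ℂ)⁻¹) • (S t x - x)) (𝓝[>] 0) (𝓝 z) := by
    intro x z h
    rw [Metric.tendsto_nhdsWithin_nhds]
    intro ε hε
    obtain ⟨x₂, hx, y₂, hxy⟩ := Metric.dense_iff.1 hG.dense z (ε / 4) (by positivity)
    rw [Metric.mem_ball, dist_comm, dist_eq_norm] at hx
    refine ⟨ε / (4 * (‖y₂‖ + 1)), by positivity, fun t ht htδ => ?_⟩
    have ht0 : 0 < t := ht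
    rw [Real.dist_eq, sub_zero, abs_of_pos ht0, lt_div_iff₀ (by positivity)] at htδ
    have h1 := hder x z h x₂ y₂ hxy t ht0.le
    have hne : (t : ℂ) ≠ 0 := by exact_mod_cast ht0.ne'
    have e : (t : ℂ)⁻¹ • (S t x - x) - z = (t : ℂ)⁻¹ • (S t x - x - (t : ℂ) • z) := by
      rw [smul_sub _ (S t x - x), inv_smul_smul₀ hne]
    rw [dist_eq_norm, e, norm_smul, norm_inv, Complex.norm_real, Real.norm_of_nonneg ht0.le,
      inv_mul_lt_iff₀ ht0]
    refine h1.trans_lt ?_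
    rw [mul_comm]
    refine mul_lt_mul_of_pos_left ?_ ht0
    nlinarith
  refine ⟨S, ⟨hzero, hadd, fun x => ?_⟩, fun x z => ⟨fun h => ?_, fun h => ?_⟩, hcon⟩
  · rw [Metric.continuousOn_iff]
    intro s hs ε hε
    obtain ⟨δ, hδ, hd⟩ := hcont0 x ε hε
    refine ⟨δ, hδ, fun t ht hts => ?_⟩
    rw [Real.dist_eq, abs_lt] at hts
    rw [dist_eq_norm]
    rcases le_total s t with hst | hst
    · exact (hcont1 x s t hs hst).trans_lt (hd _ (sub_nonneg.2 hst) (by linarith))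
    · rw [norm_sub_rev]
      exact (hcont1 x t s ht hst).trans_lt (hd _ (sub_nonneg.2 hst) (by linarith))
  · exact hfwd x z h
  -- No proper extension of the graph can arise. With `x' - y' = x - z`, the orbit of `x - x'` has
  -- derivative `x - x'` at `0`, which a contraction semigroup permits only if `x = x'`.
  · obtain ⟨x', y', hxy', hf⟩ := hG.surjective 1 one_pos (x - z)
    rw [Complex.ofReal_one, one_smul] at hf
    have h1 := h.sub (hfwd x' y' hxy')
    have e : z - y' = x - x' := by
      rw [← sub_eq_zero] at hf ⊢; rw [← hf]; abel
    rw [e] at h1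
    have h2 : Tendsto (fun t : ℝ => (t : ℂ)⁻¹ • (S t (x - x') - (x - x'))) (𝓝[>] 0)
        (𝓝 (x - x')) := h1.congr fun t => by
      rw [← smul_sub, map_sub]; congr 1; abel
    have h3 : (inner ℂ (x - x') (x - x')).re ≤ 0 := by
      refine le_of_tendsto ((Complex.continuous_re.tendsto _).comp
        (h2.inner (𝕜 := ℂ) (tendsto_const_nhds (x := x - x')))) ?_
      filter_upwards [self_mem_nhdsWithin] with t ht
      have ht0 : (0 : ℝ) < t := ht
      simp only [Function.comp_apply]
      rw [inner_smul_left, inner_sub_left, ← Complex.ofReal_inv, Complex.conj_ofReal,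
        Complex.re_ofReal_mul, Complex.sub_re]
      have h4 : (inner ℂ (S t (x - x')) (x - x')).re ≤ ‖S t (x - x')‖ * ‖x - x'‖ :=
        re_inner_le_norm (𝕜 := ℂ) _ _
      have h5 : (inner ℂ (x - x') (x - x')).re = ‖x - x'‖ ^ 2 :=
        inner_self_eq_norm_sq (𝕜 := ℂ) _
      have h6 := hcon t ht0.le (x - x')
      refine mul_nonpos_of_nonneg_of_nonpos (by positivity) ?_
      nlinarith [norm_nonneg (x - x')]
    have h5 : (inner ℂ (x - x') (x - x')).re = ‖x - x'‖ ^ 2 :=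
      inner_self_eq_norm_sq (𝕜 := ℂ) _
    have h6 : x - x' = 0 := by
      rw [h5] at h3
      simpa using h3.antisymm (by positivity)
    rw [h6, sub_eq_zero] at e
    rw [sub_eq_zero.1 h6, e]
    exact hxy'

end IsMaximalDissipative

/-! ### Orbits of a semigroup with maximal dissipative generator. -/

namespace IsGeneratorGraph

variable {H : Type*} [NormedAddCommGroup H] [InnerProductSpace ℂ H] {G : Submodule ℂ (H × H)}
  {S : ℝ → H →L[ℂ] H}

theorem mem (hA : IsGeneratorGraph S (fun x y => (x, y) ∈ G)) (hS : IsC0Semigroup S) {x y : H}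
    (h : (x, y) ∈ G) {t : ℝ} (ht : 0 ≤ t) : (S t x, S t y) ∈ G := by
  refine (hA _ _).2 ?_
  have h1 := ((S t).continuous.tendsto y).comp ((hA x y).1 h)
  refine h1.congr' ?_
  filter_upwards [self_mem_nhdsWithin] with s hs
  have hs0 : (0 : ℝ) ≤ s := le_of_lt hs
  simp only [Function.comp_apply, map_smul, map_sub]
  rw [← ContinuousLinearMap.comp_apply, ← ContinuousLinearMap.comp_apply, ← hS.add t s ht hs0,
    ← hS.add s t hs0 ht, add_comm]

theorem hasDerivWithinAt (hA : IsGeneratorGraph S (fun x y => (x, y) ∈ G)) (hS : IsC0Semigroup S)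
    {x y : H} (h : (x, y) ∈ G) {t : ℝ} (ht : 0 ≤ t) :
    HasDerivWithinAt (fun s => S s x) (S t y) (Ici t) t := by
  rw [← hasDerivWithinAt_Ioi_iff_Ici, hasDerivWithinAt_iff_tendsto_slope' self_notMem_Ioi]
  have h1 := (hA _ _).1 (hA.mem hS h ht)
  have h2 : Tendsto (fun s : ℝ => s - t) (𝓝[>] t) (𝓝[>] 0) := by
    refine tendsto_nhdsWithin_iff.2 ⟨?_, ?_⟩
    · have : Tendsto (fun s : ℝ => s - t) (𝓝 t) (𝓝 (t - t)) := tendsto_id.sub_const t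
      rw [sub_self] at this
      exact this.mono_left nhdsWithin_le_nhds
    · filter_upwards [self_mem_nhdsWithin] with s hs using sub_pos.2 (mem_Ioi.1 hs)
  refine (h1.comp h2).congr' ?_
  filter_upwards [self_mem_nhdsWithin] with s hs
  have hs0 : t < s := hs
  simp only [Function.comp_apply, slope, vsub_eq_sub]
  rw [← ContinuousLinearMap.comp_apply, ← hS.add _ t (sub_pos.2 hs0).le ht, sub_add_cancel,
    ← Complex.ofReal_inv, Complex.coe_smul]

theorem continuousOn_orbit (hS : IsC0Semigroup S) (x : H) (T : ℝ) :
    ContinuousOn (fun t => S t x) (Icc 0 T) :=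
  (hS.continuousOn x).mono fun _ ht => ht.1

/-- Integrated form of the evolution of a quadratic functional along an orbit. -/
theorem integral_re_inner (hA : IsGeneratorGraph S (fun x y => (x, y) ∈ G)) (hS : IsC0Semigroup S)
    (M : H →L[ℂ] H) {x y : H} (h : (x, y) ∈ G) {T : ℝ} (hT : 0 ≤ T) :
    ∫ t in (0 : ℝ)..T, ((inner ℂ (M (S t x)) (S t y)).re + (inner ℂ (M (S t y)) (S t x)).re) =
      (inner ℂ (M (S T x)) (S T x)).re - (inner ℂ (M x) x).re := by
  have hx := continuousOn_orbit hS x T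
  have hy := continuousOn_orbit hS y T
  have hMx := M.continuous.comp_continuousOn hx
  have hMy := M.continuous.comp_continuousOn hy
  have := intervalIntegral.integral_eq_sub_of_hasDeriv_right_of_le hT
    (f := fun t => (inner ℂ (M (S t x)) (S t x)).re)
    (f' := fun t => (inner ℂ (M (S t x)) (S t y)).re + (inner ℂ (M (S t y)) (S t x)).re)
    (Complex.continuous_re.comp_continuousOn (hMx.inner (𝕜 := ℂ) hx))
    (fun t ht => by
      have h1 := (hA.hasDerivWithinAt hS h ht.1.le).mono Ioi_subset_Ici_self
      exact hasDerivWithinAt_re_inner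
        ((M.restrictScalars ℝ).hasFDerivAt.comp_hasDerivWithinAt t h1) h1)
    (ContinuousOn.intervalIntegrable (by
      rw [uIcc_of_le hT]
      exact (Complex.continuous_re.comp_continuousOn (hMx.inner (𝕜 := ℂ) hy)).add
        (Complex.continuous_re.comp_continuousOn (hMy.inner (𝕜 := ℂ) hx))))
  rw [this, hS.zero]
  rfl

variable [CompleteSpace H]

/-- Contractivity is not part of `IsC0Semigroup`; it follows from dissipativity along orbits in the
dense domain. -/
theorem norm_apply_le (hG : IsMaximalDissipative G)
    (hA : IsGeneratorGraph S (fun x y => (x, y) ∈ G)) (hS : IsC0Semigroup S) {t : ℝ}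
    (ht : 0 ≤ t) (x : H) : ‖S t x‖ ≤ ‖x‖ := by
  refine hG.dense.induction (P := fun x => ‖S t x‖ ≤ ‖x‖) ?_
    (isClosed_le (S t).continuous.norm continuous_norm) x
  rintro x ⟨y, h⟩
  have := norm_le_of_re_inner_nonpos (u := fun s => S s x) (u' := fun s => S s y) ht
    (continuousOn_orbit hS x t) (fun s hs => hA.hasDerivWithinAt hS h hs.1)
    (fun s hs => hG.dissipative _ _ (hA.mem hS h hs.1))
  simpa [hS.zero] using this

/-- The difference of two orbits from the same point of the domain starts at zero and has
nonincreasing norm. This makes the trace operator independent of the semigroup hidden in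
`IsBoundaryTraceOperator`. -/
theorem semigroup_unique (hG : IsMaximalDissipative G) {S' : ℝ → H →L[ℂ] H}
    (hA : IsGeneratorGraph S (fun x y => (x, y) ∈ G)) (hS : IsC0Semigroup S)
    (hA' : IsGeneratorGraph S' (fun x y => (x, y) ∈ G)) (hS' : IsC0Semigroup S')
    {t : ℝ} (ht : 0 ≤ t) : S t = S' t := by
  ext x
  refine hG.dense.induction (P := fun x => S t x = S' t x) ?_
    (isClosed_eq (S t).continuous (S' t).continuous) x
  rintro x ⟨y, h⟩
  have := norm_le_of_re_inner_nonpos (u := fun s => S s x - S' s x)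
    (u' := fun s => S s y - S' s y) ht
    ((continuousOn_orbit hS x t).sub (continuousOn_orbit hS' x t))
    (fun s hs => (hA.hasDerivWithinAt hS h hs.1).sub (hA'.hasDerivWithinAt hS' h hs.1))
    (fun s hs => hG.dissipative _ _ (G.sub_mem (hA.mem hS h hs.1) (hA'.mem hS' h hs.1)))
  simpa [hS.zero, hS'.zero, sub_eq_zero] using this

end IsGeneratorGraph

/-! ### The operator `A` on `L₂(0, R)`: traces, energy identity, Kato smoothing. -/

open scoped ComplexConjugate

section

variable {R : ℝ}

theorem IntervalIntegrable.conj_complex {f : ℝ → ℂ} {a b : ℝ} (h : IntervalIntegrable f volume a b) :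
    IntervalIntegrable (fun x => conj (f x)) volume a b :=
  ⟨Complex.conjCLE.toContinuousLinearMap.integrable_comp h.1,
    Complex.conjCLE.toContinuousLinearMap.integrable_comp h.2⟩

theorem integral_Ioo_eq_interval {E : Type*} [NormedAddCommGroup E] [NormedSpace ℝ E] (hR : 0 ≤ R)
    (f : ℝ → E) : ∫ x, f x ∂(volume.restrict (Ioo (0 : ℝ) R)) = ∫ x in (0 : ℝ)..R, f x := by
  rw [intervalIntegral.integral_of_le hR, integral_Ioc_eq_integral_Ioo]

theorem L2Interval.inner_eq (hR : 0 ≤ R) {u v : L2Interval R} {f g : ℝ → ℂ}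
    (hu : ∀ᵐ x ∂(volume.restrict (Ioo (0 : ℝ) R)), u x = f x)
    (hv : ∀ᵐ x ∂(volume.restrict (Ioo (0 : ℝ) R)), v x = g x) :
    inner ℂ u v = ∫ x in (0 : ℝ)..R, g x * conj (f x) := by
  rw [L2.inner_def, ← integral_Ioo_eq_interval hR]
  refine integral_congr_ae ?_
  filter_upwards [hu, hv] with x h1 h2
  rw [h1, h2, RCLike.inner_apply]

theorem L2Interval.norm_sq_eq (hR : 0 ≤ R) {u : L2Interval R} {f : ℝ → ℂ}
    (hu : ∀ᵐ x ∂(volume.restrict (Ioo (0 : ℝ) R)), u x = f x) :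
    ‖u‖ ^ 2 = ∫ x in (0 : ℝ)..R, ‖f x‖ ^ 2 := by
  have h1 : (inner ℂ u u).re = ‖u‖ ^ 2 := inner_self_eq_norm_sq (𝕜 := ℂ) u
  rw [← h1, L2Interval.inner_eq hR hu hu]
  have h2 : ∀ x, f x * conj (f x) = ((‖f x‖ ^ 2 : ℝ) : ℂ) := fun x => by
    rw [Complex.mul_conj, Complex.normSq_eq_norm_sq]
  simp_rw [h2]
  rw [intervalIntegral.integral_ofReal, Complex.ofReal_re]

theorem L2Interval.intervalIntegrable (hR : 0 ≤ R) {f : ℝ → ℂ}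
    (hf : MemLp f 2 (volume.restrict (Ioo (0 : ℝ) R))) : IntervalIntegrable f volume 0 R := by
  rw [intervalIntegrable_iff_integrableOn_Ioo_of_le hR]
  exact hf.integrable (by norm_num)

theorem L2Interval.memLp_of_continuousOn {f : ℝ → ℂ} (hf : ContinuousOn f (Icc 0 R)) :
    MemLp f 2 (volume.restrict (Ioo (0 : ℝ) R)) := by
  obtain ⟨C, hC⟩ := isCompact_Icc.exists_bound_of_continuousOn hf
  refine MemLp.of_bound ((hf.mono Ioo_subset_Icc_self).aestronglyMeasurable measurableSet_Ioo) C ?_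
  rw [ae_restrict_iff' measurableSet_Ioo]
  exact Eventually.of_forall fun x hx => hC x (Ioo_subset_Icc_self hx)

namespace IsH3Representative

variable {y y' : L2Interval R} {y₀ y₁ y₂ y₃ z₀ z₁ z₂ z₃ : ℝ → ℂ}

theorem hasACDeriv_two (hR : 0 ≤ R) (h : IsH3Representative R y y₀ y₁ y₂ y₃) :
    HasACDeriv R y₂ y₃ :=
  ⟨L2Interval.intervalIntegrable hR h.memLp, h.deriv_two⟩

theorem hasACDeriv_one (hR : 0 ≤ R) (h : IsH3Representative R y y₀ y₁ y₂ y₃) :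
    HasACDeriv R y₁ y₂ :=
  .of_continuousOn hR (h.hasACDeriv_two hR).continuousOn h.deriv_one

theorem hasACDeriv_zero (hR : 0 ≤ R) (h : IsH3Representative R y y₀ y₁ y₂ y₃) :
    HasACDeriv R y₀ y₁ :=
  .of_continuousOn hR (h.hasACDeriv_one hR).continuousOn h.deriv_zero

theorem add (hR : 0 ≤ R) (h : IsH3Representative R y y₀ y₁ y₂ y₃)
    (h' : IsH3Representative R y' z₀ z₁ z₂ z₃) :
    IsH3Representative R (y + y') (fun x => y₀ x + z₀ x) (fun x => y₁ x + z₁ x)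
      (fun x => y₂ x + z₂ x) (fun x => y₃ x + z₃ x) where
  ae_eq := by
    filter_upwards [h.ae_eq, h'.ae_eq, Lp.coeFn_add y y'] with x h1 h2 h3
    rw [h3, Pi.add_apply, h1, h2]
  deriv_zero := ((h.hasACDeriv_zero hR).add (h'.hasACDeriv_zero hR)).isPrimitiveOn
  deriv_one := ((h.hasACDeriv_one hR).add (h'.hasACDeriv_one hR)).isPrimitiveOn
  deriv_two := ((h.hasACDeriv_two hR).add (h'.hasACDeriv_two hR)).isPrimitiveOn
  memLp := h.memLp.add h'.memLp

theorem smul (hR : 0 ≤ R) (c : ℂ) (h : IsH3Representative R y y₀ y₁ y₂ y₃) :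
    IsH3Representative R (c • y) (fun x => c * y₀ x) (fun x => c * y₁ x)
      (fun x => c * y₂ x) (fun x => c * y₃ x) where
  ae_eq := by
    filter_upwards [h.ae_eq, Lp.coeFn_smul c y] with x h1 h3
    rw [h3, Pi.smul_apply, h1, smul_eq_mul]
  deriv_zero := ((h.hasACDeriv_zero hR).const_mul c).isPrimitiveOn
  deriv_one := ((h.hasACDeriv_one hR).const_mul c).isPrimitiveOn
  deriv_two := ((h.hasACDeriv_two hR).const_mul c).isPrimitiveOn
  memLp := h.memLp.const_mul c

/-- A continuous function vanishing almost everywhere vanishes identically, and so in turn do its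
derivatives. Hence traces of `H³` functions are well defined. -/
theorem eq_zero (hR : 0 < R) (h : IsH3Representative R 0 y₀ y₁ y₂ y₃) :
    (∀ x ∈ Icc (0 : ℝ) R, y₀ x = 0) ∧ (∀ x ∈ Icc (0 : ℝ) R, y₁ x = 0) ∧
      (∀ x ∈ Icc (0 : ℝ) R, y₂ x = 0) ∧ ∀ᵐ x ∂(volume.restrict (Ioo (0 : ℝ) R)), y₃ x = 0 := by
  have h0 : ∀ x ∈ Icc (0 : ℝ) R, y₀ x = 0 := by
    have h1 : ∀ᵐ x ∂(volume.restrict (Ioo (0 : ℝ) R)), y₀ x = 0 := by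
      filter_upwards [h.ae_eq, Lp.coeFn_zero ℂ 2 (volume.restrict (Ioo (0 : ℝ) R))] with x h1 h2
      rw [← h1, h2, Pi.zero_apply]
    rw [Measure.restrict_congr_set (Ioo_ae_eq_Icc (μ := volume))] at h1
    exact Measure.eqOn_Icc_of_ae_eq volume hR.ne h1 (h.hasACDeriv_zero hR.le).continuousOn
      continuousOn_const
  have h1 := (h.hasACDeriv_zero hR.le).deriv_zero_of_continuousOn hR
    (h.hasACDeriv_one hR.le).continuousOn h0
  have h2 := (h.hasACDeriv_one hR.le).deriv_zero_of_continuousOn hR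
    (h.hasACDeriv_two hR.le).continuousOn h1
  exact ⟨h0, h1, h2, (h.hasACDeriv_two hR.le).deriv_ae_zero hR.le h2⟩

end IsH3Representative

theorem HasDerivTraceAtZero.add (hR : 0 ≤ R) {y y' : L2Interval R} {d d' : ℂ}
    (h : HasDerivTraceAtZero R y d) (h' : HasDerivTraceAtZero R y' d') :
    HasDerivTraceAtZero R (y + y') (d + d') := by
  obtain ⟨_, _, _, _, h, rfl⟩ := h
  obtain ⟨_, _, _, _, h', rfl⟩ := h'
  exact ⟨_, _, _, _, h.add hR h', rfl⟩

theorem HasDerivTraceAtZero.smul (hR : 0 ≤ R) {y : L2Interval R} {d : ℂ} (c : ℂ)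
    (h : HasDerivTraceAtZero R y d) : HasDerivTraceAtZero R (c • y) (c * d) := by
  obtain ⟨_, _, _, _, h, rfl⟩ := h
  exact ⟨_, _, _, _, h.smul hR c, rfl⟩

theorem HasDerivTraceAtZero.unique (hR : 0 < R) {y : L2Interval R} {d d' : ℂ}
    (h : HasDerivTraceAtZero R y d) (h' : HasDerivTraceAtZero R y d') : d = d' := by
  have h1 := h.add hR.le (h'.smul hR.le (-1))
  rw [neg_smul, one_smul, add_neg_cancel] at h1
  obtain ⟨_, y₁, _, _, h2, h3⟩ := h1
  have := (h2.eq_zero hR).2.1 0 ⟨le_rfl, hR.le⟩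
  rw [h3] at this
  linear_combination this

/-- The graph of `A y = -y''' + i a y'' - b y'` as a linear subspace. -/
def hnlsSubmodule (a b : ℝ) (hR : 0 < R) : Submodule ℂ (L2Interval R × L2Interval R) where
  carrier := {p | HNLSGraph a b R p.1 p.2}
  add_mem' := by
    rintro ⟨y, z⟩ ⟨y', z'⟩ ⟨y₀, y₁, y₂, y₃, h, h0, h1, h2, h3⟩ ⟨z₀, z₁, z₂, z₃, h', h0', h1', h2', h3'⟩
    refine ⟨_, _, _, _, h.add hR.le h', by simp [h0, h0'], by simp [h1, h1'], by simp [h2, h2'], ?_⟩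
    filter_upwards [h3, h3', Lp.coeFn_add z z'] with x e1 e2 e3
    simp only [Prod.snd_add] at *
    rw [e3, Pi.add_apply, e1, e2]
    ring
  zero_mem' := by
    refine ⟨fun _ => 0, fun _ => 0, fun _ => 0, fun _ => 0, ⟨?_, ?_, ?_, ?_, ?_⟩, rfl, rfl, rfl, ?_⟩
    · exact Lp.coeFn_zero ℂ 2 _
    · intro x _; simp
    · intro x _; simp
    · intro x _; simp
    · exact MemLp.zero'
    · filter_upwards [Lp.coeFn_zero ℂ 2 (volume.restrict (Ioo (0 : ℝ) R))] with x hx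
      simpa using hx
  smul_mem' := by
    rintro c ⟨y, z⟩ ⟨y₀, y₁, y₂, y₃, h, h0, h1, h2, h3⟩
    refine ⟨_, _, _, _, h.smul hR.le c, by simp [h0], by simp [h1], by simp [h2], ?_⟩
    filter_upwards [h3, Lp.coeFn_smul c z] with x e1 e3
    simp only [Prod.smul_snd] at *
    rw [e3, Pi.smul_apply, e1, smul_eq_mul]
    ring

section Identities

variable {a b : ℝ} {y₀ y₁ y₂ y₃ : ℝ → ℂ}

/-- The density whose derivative is `2 Re ((A y) ȳ)`. -/
def energyFlux (a b : ℝ) (y₀ y₁ y₂ : ℝ → ℂ) (x : ℝ) : ℂ :=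
  -(y₂ x * conj (y₀ x)) - y₀ x * conj (y₂ x) + y₁ x * conj (y₁ x) +
    Complex.I * a * (y₁ x * conj (y₀ x) - y₀ x * conj (y₁ x)) - b * (y₀ x * conj (y₀ x))

/-- Because `a` and `b` are real, the lower-order contributions are total derivatives too: `2 Re (i
a y'' ȳ) = (i a (y' ȳ - y ȳ'))'`. -/
theorem hasACDeriv_energyFlux (hR : 0 ≤ R) (h0 : HasACDeriv R y₀ y₁) (h1 : HasACDeriv R y₁ y₂)
    (h2 : HasACDeriv R y₂ y₃) :
    HasACDeriv R (energyFlux a b y₀ y₁ y₂)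
      (fun x => (-y₃ x + Complex.I * (a : ℂ) * y₂ x - (b : ℂ) * y₁ x) * conj (y₀ x) +
        y₀ x * conj (-y₃ x + Complex.I * (a : ℂ) * y₂ x - (b : ℂ) * y₁ x)) := by
  have := ((((h2.mul hR h0.conj).neg.sub (h0.mul hR h2.conj)).add (h1.mul hR h1.conj)).add
    (((h1.mul hR h0.conj).sub (h0.mul hR h1.conj)).const_mul (Complex.I * a))).sub
    ((h0.mul hR h0.conj).const_mul b)
  refine this.congr_deriv hR (Eventually.of_forall fun x => ?_)
  simp only [map_add, map_sub, map_neg, map_mul, Complex.conj_I, Complex.conj_ofReal]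
  ring

end Identities

/-- `2 Re ⟨A y, y⟩ = -|y'(0)|²` on the domain of `A`. -/
theorem two_mul_re_inner_eq {a b : ℝ} (hR : 0 < R) {y z : L2Interval R} {d : ℂ}
    (h : HNLSGraph a b R y z) (hd : HasDerivTraceAtZero R y d) :
    2 * (inner ℂ z y).re = -‖d‖ ^ 2 := by
  obtain ⟨y₀, y₁, y₂, y₃, h, e0, e1, e2, hz⟩ := h
  obtain rfl : y₁ 0 = d := HasDerivTraceAtZero.unique hR ⟨y₀, y₁, y₂, y₃, h, rfl⟩ hd
  have h0 := h.hasACDeriv_zero hR.le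
  have h1 := h.hasACDeriv_one hR.le
  have h2 := h.hasACDeriv_two hR.le
  -- The flux vanishes at `R`, and at `0` only `|y'(0)|²` survives.
  have H := (hasACDeriv_energyFlux (a := a) (b := b) hR.le h0 h1 h2).integral_eq hR.le
  have hw : IntervalIntegrable
      (fun x => -y₃ x + Complex.I * (a : ℂ) * y₂ x - (b : ℂ) * y₁ x) volume 0 R :=
    (h2.neg.intervalIntegrable.add (h1.intervalIntegrable.const_mul _)).sub
      (h0.intervalIntegrable.const_mul _)
  have c0 := h0.continuousOn
  have c0' := h0.conj.continuousOn
  rw [← uIcc_of_le hR.le] at c0 c0'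
  have hw' : IntervalIntegrable
      (fun x => conj (-y₃ x + Complex.I * (a : ℂ) * y₂ x - (b : ℂ) * y₁ x)) volume 0 R :=
    hw.conj_complex
  rw [intervalIntegral.integral_add (hw.mul_continuousOn c0') (hw'.continuousOn_mul c0),
    ← L2Interval.inner_eq hR.le h.ae_eq hz, ← L2Interval.inner_eq hR.le hz h.ae_eq,
    ← inner_conj_symm y z, add_comm, Complex.add_conj] at H
  have H' := congrArg Complex.re H
  simp only [energyFlux, e0, e1, e2, Complex.ofReal_re, map_zero, mul_zero, zero_mul, sub_zero,
    neg_zero, add_zero, zero_add, zero_sub, Complex.neg_re] at H'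
  rw [H', Complex.mul_conj, Complex.ofReal_re, Complex.normSq_eq_norm_sq]

/-- The Kato smoothing inequality in the domain of `A`, with `m` representing `x y(x)`. -/
theorem kato_inequality {a b : ℝ} (hR : 0 < R) {y z m : L2Interval R} {y₀ y₁ y₂ y₃ : ℝ → ℂ}
    (h : IsH3Representative R y y₀ y₁ y₂ y₃) (e0 : y₀ 0 = 0) (e1 : y₀ R = 0) (e2 : y₁ R = 0)
    (hz : ∀ᵐ x ∂(volume.restrict (Ioo (0 : ℝ) R)),
      z x = -y₃ x + Complex.I * (a : ℂ) * y₂ x - (b : ℂ) * y₁ x)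
    (hm : ∀ᵐ x ∂(volume.restrict (Ioo (0 : ℝ) R)), m x = (x : ℂ) * y x) :
    2 * (inner ℂ m z).re + 2 * ∫ x in (0 : ℝ)..R, ‖y₁ x‖ ^ 2 ≤ (a ^ 2 + |b|) * ‖y‖ ^ 2 := by
  have h0 := h.hasACDeriv_zero hR.le
  have h1 := h.hasACDeriv_one hR.le
  have h2 := h.hasACDeriv_two hR.le
  have hm' : ∀ᵐ x ∂(volume.restrict (Ioo (0 : ℝ) R)), m x = (x : ℂ) * y₀ x := by
    filter_upwards [hm, h.ae_eq] with x p q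
    rw [p, q]
  have hx : HasACDeriv R (fun x : ℝ => (x : ℂ)) (fun _ => 1) :=
    .of_hasDerivAt (fun x => Complex.ofRealCLM.hasDerivAt) continuous_const
  -- Adding `(|y|²)''` to `(x · flux)'` cancels the `y'' ȳ` terms of the flux and leaves the density
  -- `ρ`, which contains `3 |y'|²`. All boundary values vanish, so `2 Re ⟨m, z⟩ + ∫ ρ = 0`.
  have H1 := hx.mul hR.le (hasACDeriv_energyFlux (a := a) (b := b) hR.le h0 h1 h2)
  have H2 := (h1.mul hR.le h0.conj).add (h0.mul hR.le h1.conj)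
  have H := (H1.add H2).integral_eq hR.le
  have hw : IntervalIntegrable
      (fun x => -y₃ x + Complex.I * (a : ℂ) * y₂ x - (b : ℂ) * y₁ x) volume 0 R :=
    (h2.neg.intervalIntegrable.add (h1.intervalIntegrable.const_mul _)).sub
      (h0.intervalIntegrable.const_mul _)
  have c0 := h0.continuousOn
  have c1 := h1.continuousOn
  have cx := (hx.mul hR.le h0).continuousOn
  have cx' := (hx.mul hR.le h0).conj.continuousOn
  rw [← uIcc_of_le hR.le] at c0 c1 cx cx'
  have hw' : IntervalIntegrable
      (fun x => conj (-y₃ x + Complex.I * (a : ℂ) * y₂ x - (b : ℂ) * y₁ x)) volume 0 R :=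
    hw.conj_complex
  set ρ : ℝ → ℝ := fun x => 3 * ‖y₁ x‖ ^ 2 - 2 * a * (y₁ x * conj (y₀ x)).im - b * ‖y₀ x‖ ^ 2
    with hρ
  have cρ : ContinuousOn ρ (uIcc 0 R) :=
    (((c1.norm.pow 2).const_mul 3).sub ((Complex.continuous_im.comp_continuousOn
      (c1.mul (Complex.continuous_conj.comp_continuousOn c0))).const_mul _)).sub
      ((c0.norm.pow 2).const_mul b)
  have iρ : IntervalIntegrable (fun x => (ρ x : ℂ)) volume 0 R :=
    (Complex.continuous_ofReal.comp_continuousOn cρ).intervalIntegrable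
  have e : (fun x => 1 * energyFlux a b y₀ y₁ y₂ x + (x : ℂ) *
      ((-y₃ x + Complex.I * (a : ℂ) * y₂ x - (b : ℂ) * y₁ x) * conj (y₀ x) +
        y₀ x * conj (-y₃ x + Complex.I * (a : ℂ) * y₂ x - (b : ℂ) * y₁ x)) +
      (y₂ x * conj (y₀ x) + y₁ x * conj (y₁ x) + (y₁ x * conj (y₁ x) + y₀ x * conj (y₂ x)))) =
      fun x => (-y₃ x + Complex.I * (a : ℂ) * y₂ x - (b : ℂ) * y₁ x) * conj ((x : ℂ) * y₀ x) +
        ((x : ℂ) * y₀ x) * conj (-y₃ x + Complex.I * (a : ℂ) * y₂ x - (b : ℂ) * y₁ x) + ρ x := by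
    funext x
    have q1 : ∀ c : ℂ, (((‖c‖ ^ 2 : ℝ)) : ℂ) = c * conj c := fun c => by
      rw [Complex.mul_conj, Complex.normSq_eq_norm_sq]
    have q2 : (((y₁ x * conj (y₀ x)).im : ℝ) : ℂ) * (2 * Complex.I) =
        y₁ x * conj (y₀ x) - y₀ x * conj (y₁ x) := by
      have := Complex.sub_conj (y₁ x * conj (y₀ x))
      rw [map_mul, Complex.conj_conj, mul_comm (conj (y₁ x))] at this
      rw [this]; push_cast; ring
    have q3 : (ρ x : ℂ) = 3 * (y₁ x * conj (y₁ x)) +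
        Complex.I * a * (y₁ x * conj (y₀ x) - y₀ x * conj (y₁ x)) - b * (y₀ x * conj (y₀ x)) := by
      rw [← q2, ← q1, ← q1, hρ]
      push_cast
      linear_combination (-2 * (a : ℂ) * ((y₁ x * conj (y₀ x)).im : ℝ)) * Complex.I_sq
    rw [q3, energyFlux, map_mul, Complex.conj_ofReal]
    ring
  rw [e, intervalIntegral.integral_add ((hw.mul_continuousOn cx').add (hw'.continuousOn_mul cx)) iρ,
    intervalIntegral.integral_add (hw.mul_continuousOn cx') (hw'.continuousOn_mul cx),
    ← L2Interval.inner_eq hR.le hm' hz, ← L2Interval.inner_eq hR.le hz hm',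
    ← inner_conj_symm z m, Complex.add_conj, intervalIntegral.integral_ofReal] at H
  have H' := congrArg Complex.re H
  simp only [energyFlux, e0, e1, e2, Complex.ofReal_re, map_zero, mul_zero, zero_mul, sub_zero,
    neg_zero, add_zero, zero_add, Complex.add_re, Complex.ofReal_zero, Complex.zero_re] at H'
  have hle : ∫ x in (0 : ℝ)..R, (2 * ‖y₁ x‖ ^ 2 - (a ^ 2 + |b|) * ‖y₀ x‖ ^ 2) ≤
      ∫ x in (0 : ℝ)..R, ρ x := by
    refine intervalIntegral.integral_mono_on hR.le ?_ cρ.intervalIntegrable fun x _ => ?_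
    · exact (((c1.norm.pow 2).const_mul 2).sub
        ((c0.norm.pow 2).const_mul _)).intervalIntegrable
    · have p1 : |(y₁ x * conj (y₀ x)).im| ≤ ‖y₁ x‖ * ‖y₀ x‖ := by
        refine (Complex.abs_im_le_norm _).trans ?_
        rw [norm_mul, Complex.norm_conj]
      have p2 : 2 * a * (y₁ x * conj (y₀ x)).im ≤ 2 * |a| * (‖y₁ x‖ * ‖y₀ x‖) := by
        refine (le_abs_self _).trans ?_
        rw [abs_mul, abs_mul, abs_two]
        exact mul_le_mul_of_nonneg_left p1 (by positivity)
      have p3 : b * ‖y₀ x‖ ^ 2 ≤ |b| * ‖y₀ x‖ ^ 2 :=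
        mul_le_mul_of_nonneg_right (le_abs_self b) (by positivity)
      -- One of the three copies of `|y'|²` absorbs the cross term: `2 |a| |y'| |y| ≤ |y'|² + a²
      -- |y|²`.
      have p4 := sq_nonneg (‖y₁ x‖ - |a| * ‖y₀ x‖)
      have p5 := sq_abs a
      simp only [hρ]
      nlinarith
  have i1 : IntervalIntegrable (fun x => 2 * ‖y₁ x‖ ^ 2) volume 0 R :=
    ((c1.norm.pow 2).const_mul 2).intervalIntegrable
  have i0 : IntervalIntegrable (fun x => (a ^ 2 + |b|) * ‖y₀ x‖ ^ 2) volume 0 R :=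
    ((c0.norm.pow 2).const_mul _).intervalIntegrable
  rw [intervalIntegral.integral_sub i1 i0, intervalIntegral.integral_const_mul,
    intervalIntegral.integral_const_mul, ← L2Interval.norm_sq_eq hR.le h.ae_eq] at hle
  linarith

/-- Interpolation of the `L₂` norm between `y'` and a primitive of `y`. -/
theorem norm_sq_le_interpolation (hR : 0 < R) {y v : L2Interval R} {y₀ y₁ : ℝ → ℂ}
    (hy : ∀ᵐ x ∂(volume.restrict (Ioo (0 : ℝ) R)), y x = y₀ x) (h : HasACDeriv R y₀ y₁)
    (hc : ContinuousOn y₁ (Icc 0 R)) (e0 : y₀ 0 = 0) (e1 : y₀ R = 0)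
    (hv : ∀ᵐ x ∂(volume.restrict (Ioo (0 : ℝ) R)), v x = ∫ s in (0 : ℝ)..x, y s)
    {ε : ℝ} (hε : 0 < ε) :
    ‖y‖ ^ 2 ≤ ε * (∫ x in (0 : ℝ)..R, ‖y₁ x‖ ^ 2) + 1 / (4 * ε) * ‖v‖ ^ 2 := by
  have h' : HasACDeriv R (fun x => ∫ s in (0 : ℝ)..x, y₀ s) y₀ :=
    .of_continuousOn hR.le h.continuousOn fun x _ => by simp
  have hv' : ∀ᵐ x ∂(volume.restrict (Ioo (0 : ℝ) R)), v x = ∫ s in (0 : ℝ)..x, y₀ s := by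
    have hI := ae_restrict_mem (μ := volume) (measurableSet_Ioo (a := (0 : ℝ)) (b := R))
    filter_upwards [hv, hI] with x p hx
    rw [p]
    refine intervalIntegral.integral_congr_ae_restrict ?_
    rw [uIoc_of_le hx.1.le]
    exact ae_restrict_of_ae_restrict_of_subset (Ioc_subset_Ioo_right hx.2) hy
  -- With `V` the primitive of `y`, the integral of `(y V̄)' = y' V̄ + |y|²` is zero; Young's
  -- inequality then bounds `-∫ y' V̄`.
  have H := (h.mul hR.le h'.conj).integral_eq hR.le
  have c0 := h.continuousOn
  have cV := h'.continuousOn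
  rw [← uIcc_of_le hR.le] at hc c0 cV
  have i1 : IntervalIntegrable (fun x => ε * ‖y₁ x‖ ^ 2) volume 0 R :=
    ((hc.norm.pow 2).const_mul ε).intervalIntegrable
  have i2 : IntervalIntegrable (fun x => 1 / (4 * ε) * ‖∫ s in (0 : ℝ)..x, y₀ s‖ ^ 2) volume 0 R :=
    ((cV.norm.pow 2).const_mul _).intervalIntegrable
  have c3 : ContinuousOn (fun x => y₁ x * conj (∫ s in (0 : ℝ)..x, y₀ s) + y₀ x * conj (y₀ x))
      (uIcc 0 R) :=
    (hc.mul (Complex.continuous_conj.comp_continuousOn cV)).add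
      (c0.mul (Complex.continuous_conj.comp_continuousOn c0))
  have i3 : IntervalIntegrable
      (fun x => (y₁ x * conj (∫ s in (0 : ℝ)..x, y₀ s) + y₀ x * conj (y₀ x)).re) volume 0 R :=
    (Complex.continuous_re.comp_continuousOn c3).intervalIntegrable
  have H' : ∫ x in (0 : ℝ)..R,
      (y₁ x * conj (∫ s in (0 : ℝ)..x, y₀ s) + y₀ x * conj (y₀ x)).re = 0 := by
    have := Complex.reCLM.intervalIntegral_comp_comm (c3.intervalIntegrable (μ := volume))
    simp only [Complex.reCLM_apply] at this
    rw [this, H, e0, e1]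
    simp
  rw [L2Interval.norm_sq_eq hR.le hy, L2Interval.norm_sq_eq hR.le hv',
    ← intervalIntegral.integral_const_mul, ← intervalIntegral.integral_const_mul,
    ← intervalIntegral.integral_add i1 i2]
  have i12 : IntervalIntegrable (fun x => ε * ‖y₁ x‖ ^ 2 +
      1 / (4 * ε) * ‖∫ s in (0 : ℝ)..x, y₀ s‖ ^ 2) volume 0 R := i1.add i2
  have key := intervalIntegral.integral_add i12 i3
  rw [H', add_zero] at key
  rw [← key]
  have i0 : IntervalIntegrable (fun x => ‖y₀ x‖ ^ 2) volume 0 R :=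
    (c0.norm.pow 2).intervalIntegrable
  refine intervalIntegral.integral_mono_on hR.le i0 (i12.add i3) fun x _ => ?_
  set V := ∫ s in (0 : ℝ)..x, y₀ s
  have q1 : (y₀ x * conj (y₀ x)).re = ‖y₀ x‖ ^ 2 := by
    rw [Complex.mul_conj, Complex.ofReal_re, Complex.normSq_eq_norm_sq]
  have q2 : |(y₁ x * conj V).re| ≤ ‖y₁ x‖ * ‖V‖ := by
    refine (Complex.abs_re_le_norm _).trans ?_
    rw [norm_mul, Complex.norm_conj]
  have q3 := (abs_le.1 q2).1
  have q4 : ‖y₁ x‖ * ‖V‖ ≤ ε * ‖y₁ x‖ ^ 2 + 1 / (4 * ε) * ‖V‖ ^ 2 := by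
    have := mul_nonneg hε.le (sq_nonneg (‖y₁ x‖ - 1 / (2 * ε) * ‖V‖))
    have e : ε * (‖y₁ x‖ - 1 / (2 * ε) * ‖V‖) ^ 2 =
        ε * ‖y₁ x‖ ^ 2 + 1 / (4 * ε) * ‖V‖ ^ 2 - ‖y₁ x‖ * ‖V‖ := by
      field_simp
      ring
    linarith
  rw [Complex.add_re, q1]
  linarith

end

/-! ### The resolvent equation as a third order ODE. -/

section

variable {R : ℝ}

/-- Factorization of a complex cubic into linear factors. -/
theorem exists_cubic_roots (p q r : ℂ) :
    ∃ m₁ m₂ m₃ : ℂ, m₁ + m₂ + m₃ = p ∧ m₁ * m₂ + m₁ * m₃ + m₂ * m₃ = q ∧ m₁ * m₂ * m₃ = r := by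
  obtain ⟨m₁, h₁⟩ := IsAlgClosed.exists_root
    (Polynomial.X ^ 3 - Polynomial.C p * Polynomial.X ^ 2 + Polynomial.C q * Polynomial.X -
      Polynomial.C r : Polynomial ℂ) (by
        have : (Polynomial.X ^ 3 - Polynomial.C p * Polynomial.X ^ 2 +
          Polynomial.C q * Polynomial.X - Polynomial.C r : Polynomial ℂ).degree = 3 := by
          compute_degree!
        rw [this]; norm_num)
  obtain ⟨m₂, h₂⟩ := IsAlgClosed.exists_root
    (Polynomial.X ^ 2 - Polynomial.C (p - m₁) * Polynomial.X +
      Polynomial.C (q - m₁ * (p - m₁)) : Polynomial ℂ) (by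
        have : (Polynomial.X ^ 2 - Polynomial.C (p - m₁) * Polynomial.X +
          Polynomial.C (q - m₁ * (p - m₁)) : Polynomial ℂ).degree = 2 := by
          compute_degree!
        rw [this]; norm_num)
  simp only [Polynomial.IsRoot.def, Polynomial.eval_add, Polynomial.eval_sub, Polynomial.eval_mul,
    Polynomial.eval_pow, Polynomial.eval_X, Polynomial.eval_C] at h₁ h₂
  refine ⟨m₁, m₂, p - m₁ - m₂, by ring, by linear_combination -h₂, ?_⟩
  linear_combination h₁ - m₁ * h₂

/-- The solution of `w' = m w + f`, `w(0) = c`. -/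
noncomputable def firstOrderSolution (m c : ℂ) (f : ℝ → ℂ) (x : ℝ) : ℂ :=
  Complex.exp (m * x) * (c + ∫ s in (0 : ℝ)..x, Complex.exp (-m * s) * f s)

theorem firstOrderSolution_zero (m c : ℂ) (f : ℝ → ℂ) : firstOrderSolution m c f 0 = c := by
  simp [firstOrderSolution]

theorem hasACDeriv_exp (m : ℂ) :
    HasACDeriv R (fun x : ℝ => Complex.exp (m * x)) (fun x => m * Complex.exp (m * x)) := by
  refine .of_hasDerivAt (fun x => ?_) (by fun_prop)
  have := (((hasDerivAt_id (x : ℂ)).const_mul m).cexp).comp_ofReal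
  simpa [mul_comm] using this

theorem hasACDeriv_firstOrderSolution (hR : 0 ≤ R) (m c : ℂ) {f : ℝ → ℂ}
    (hf : IntervalIntegrable f volume 0 R) :
    HasACDeriv R (firstOrderSolution m c f) (fun x => m * firstOrderSolution m c f x + f x) := by
  have h1 : HasACDeriv R (fun x => c + ∫ s in (0 : ℝ)..x, Complex.exp (-m * s) * f s)
      (fun x => Complex.exp (-m * x) * f x) :=
    ⟨hf.continuousOn_mul (by fun_prop), fun x _ => by simp⟩
  refine ((hasACDeriv_exp m).mul hR h1).congr_deriv hR (Eventually.of_forall fun x => ?_)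
  have : Complex.exp (m * x) * Complex.exp (-m * x) = 1 := by
    rw [← Complex.exp_add]; simp
  simp only [firstOrderSolution]
  linear_combination f x * this

/-- `y''' - i a y'' + b y' + l y = F` on `[0, R]`, with `y'''` square integrable. -/
structure IsODESolution (a b R : ℝ) (l : ℂ) (F y₀ y₁ y₂ y₃ : ℝ → ℂ) : Prop where
  deriv_zero : HasACDeriv R y₀ y₁
  deriv_one : HasACDeriv R y₁ y₂
  deriv_two : HasACDeriv R y₂ y₃
  memLp : MemLp y₃ 2 (volume.restrict (Ioo (0 : ℝ) R))
  eqn : ∀ x, y₃ x - Complex.I * a * y₂ x + b * y₁ x + l * y₀ x = F x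

namespace IsODESolution

variable {a b : ℝ} {l : ℂ} {F F' y₀ y₁ y₂ y₃ z₀ z₁ z₂ z₃ : ℝ → ℂ}

theorem add (h : IsODESolution a b R l F y₀ y₁ y₂ y₃) (h' : IsODESolution a b R l F' z₀ z₁ z₂ z₃) :
    IsODESolution a b R l (fun x => F x + F' x) (fun x => y₀ x + z₀ x) (fun x => y₁ x + z₁ x)
      (fun x => y₂ x + z₂ x) (fun x => y₃ x + z₃ x) :=
  ⟨h.deriv_zero.add h'.deriv_zero, h.deriv_one.add h'.deriv_one, h.deriv_two.add h'.deriv_two,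
    h.memLp.add h'.memLp, fun x => by rw [← h.eqn, ← h'.eqn]; ring⟩

theorem const_mul (c : ℂ) (h : IsODESolution a b R l F y₀ y₁ y₂ y₃) :
    IsODESolution a b R l (fun x => c * F x) (fun x => c * y₀ x) (fun x => c * y₁ x)
      (fun x => c * y₂ x) (fun x => c * y₃ x) :=
  ⟨h.deriv_zero.const_mul c, h.deriv_one.const_mul c, h.deriv_two.const_mul c,
    h.memLp.const_mul c, fun x => by rw [← h.eqn]; ring⟩

/-- The operator factors as `(D - m₁)(D - m₂)(D - m₃)`, so three first order equations are solved in
succession. -/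
theorem exists_initial_data (hR : 0 ≤ R) (l : ℂ) {F : ℝ → ℂ}
    (hF : MemLp F 2 (volume.restrict (Ioo (0 : ℝ) R))) (c d : ℂ) :
    ∃ y₀ y₁ y₂ y₃, IsODESolution a b R l F y₀ y₁ y₂ y₃ ∧ y₀ 0 = 0 ∧ y₁ 0 = c ∧ y₂ 0 = d := by
  obtain ⟨m₁, m₂, m₃, hp, hq, hr⟩ := exists_cubic_roots (Complex.I * a) b (-l)
  -- Here `g = y' - m₃ y` and `h = g' - m₂ g`, whence the initial values `g(0) = c` and `h(0) = d -
  -- (m₂ + m₃) c`.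
  set h := firstOrderSolution m₁ (d - (m₂ + m₃) * c) F with hh
  have Hh : HasACDeriv R h (fun x => m₁ * h x + F x) :=
    hasACDeriv_firstOrderSolution hR _ _ (L2Interval.intervalIntegrable hR hF)
  have hint : ∀ {u : ℝ → ℂ}, ContinuousOn u (Icc 0 R) → IntervalIntegrable u volume 0 R :=
    fun hu => ContinuousOn.intervalIntegrable (by rwa [uIcc_of_le hR])
  set g := firstOrderSolution m₂ c h with hg
  have Hg : HasACDeriv R g (fun x => m₂ * g x + h x) :=
    hasACDeriv_firstOrderSolution hR _ _ (hint Hh.continuousOn)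
  set y := firstOrderSolution m₃ 0 g with hy
  have Hy : HasACDeriv R y (fun x => m₃ * y x + g x) :=
    hasACDeriv_firstOrderSolution hR _ _ (hint Hg.continuousOn)
  have H1 := (Hy.const_mul m₃).add Hg
  have H2 := (H1.const_mul m₃).add ((Hg.const_mul m₂).add Hh)
  refine ⟨y, _, _, _, ⟨Hy, H1, H2, ?_, fun x => ?_⟩, ?_, ?_, ?_⟩
  · have c1 : MemLp (fun x => m₃ * (m₃ * (m₃ * y x + g x) + (m₂ * g x + h x)) +
        m₂ * (m₂ * g x + h x) + m₁ * h x) 2 (volume.restrict (Ioo (0 : ℝ) R)) := by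
      refine L2Interval.memLp_of_continuousOn ?_
      have q1 := Hy.continuousOn
      have q2 := Hg.continuousOn
      have q3 := Hh.continuousOn
      fun_prop
    exact (c1.add hF).ae_eq (Eventually.of_forall fun x => by simp only [Pi.add_apply]; ring)
  · linear_combination (m₃ * (m₃ * y x + g x) + (m₂ * g x + h x)) * hp -
      (m₃ * y x + g x) * hq + y x * hr
  · exact firstOrderSolution_zero _ _ _
  · simp only [hy, hg, firstOrderSolution_zero]; ring
  · simp only [hy, hg, hh, firstOrderSolution_zero]; ring

/-- The element of `L₂` represented by a solution. -/
theorem exists_isH3Representative (h : IsODESolution a b R l F y₀ y₁ y₂ y₃) :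
    ∃ y : L2Interval R, IsH3Representative R y y₀ y₁ y₂ y₃ :=
  ⟨(L2Interval.memLp_of_continuousOn h.deriv_zero.continuousOn).toLp y₀,
    (L2Interval.memLp_of_continuousOn h.deriv_zero.continuousOn).coeFn_toLp,
    h.deriv_zero.isPrimitiveOn, h.deriv_one.isPrimitiveOn, h.deriv_two.isPrimitiveOn, h.memLp⟩

end IsODESolution

/-- Shooting from `0`: `p`, `q` are the homogeneous solutions with `(y'(0), y''(0))` equal to `(1,
0)` and `(0, 1)`, and `r` is a particular solution. The conditions at `R` form a square linear
system. It is injective because a kernel element satisfies `A y = l y`, so `2 l ‖y‖² = -|y'(0)|²`.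
-/
theorem exists_sub_eq (a b : ℝ) (hR : 0 < R) {l : ℝ} (hl : 0 < l) (f : L2Interval R) :
    ∃ y z, HNLSGraph a b R y z ∧ (l : ℂ) • y - z = f := by
  obtain ⟨p₀, p₁, p₂, p₃, hp, p0, p1, p2⟩ := IsODESolution.exists_initial_data (a := a) (b := b)
    hR.le (l : ℂ) (MemLp.zero' : MemLp (fun _ : ℝ => (0 : ℂ)) 2 _) 1 0
  obtain ⟨q₀, q₁, q₂, q₃, hq, q0, q1, q2⟩ := IsODESolution.exists_initial_data (a := a) (b := b)
    hR.le (l : ℂ) (MemLp.zero' : MemLp (fun _ : ℝ => (0 : ℂ)) 2 _) 0 1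
  obtain ⟨r₀, r₁, r₂, r₃, hr, r0, r1, r2⟩ := IsODESolution.exists_initial_data (a := a) (b := b)
    hR.le (l : ℂ) (Lp.memLp f) 0 0
  let Λ : ℂ × ℂ →ₗ[ℂ] ℂ × ℂ :=
    { toFun := fun s => (s.1 * p₀ R + s.2 * q₀ R, s.1 * p₁ R + s.2 * q₁ R)
      map_add' := fun s t => by ext <;> simp <;> ring
      map_smul' := fun c s => by ext <;> simp <;> ring }
  have hinj : Function.Injective Λ := by
    rw [injective_iff_map_eq_zero]
    rintro ⟨c, d⟩ hcd
    have hs := (hp.const_mul c).add (hq.const_mul d)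
    obtain ⟨y, hy⟩ := hs.exists_isH3Representative
    simp only [Λ, LinearMap.coe_mk, AddHom.coe_mk, Prod.mk_eq_zero] at hcd
    have hgr : HNLSGraph a b R y ((l : ℂ) • y) := by
      refine ⟨_, _, _, _, hy, by simp [p0, q0], hcd.1, hcd.2, ?_⟩
      filter_upwards [hy.ae_eq, Lp.coeFn_smul (l : ℂ) y] with x e1 e2
      rw [e2, Pi.smul_apply, e1, smul_eq_mul]
      linear_combination hs.eqn x
    have h1 := two_mul_re_inner_eq hR hgr ⟨_, _, _, _, hy, rfl⟩
    have h2 : (inner ℂ y y).re = ‖y‖ ^ 2 := inner_self_eq_norm_sq (𝕜 := ℂ) y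
    rw [inner_smul_left, Complex.conj_ofReal, Complex.re_ofReal_mul, h2] at h1
    have h3 : y = 0 := by
      have : l * ‖y‖ ^ 2 ≤ 0 := by nlinarith [sq_nonneg ‖c * p₁ 0 + d * q₁ 0‖]
      have h4 : ‖y‖ ^ 2 ≤ 0 := by
        by_contra hc
        push Not at hc
        nlinarith
      simpa using h4.antisymm (by positivity)
    rw [h3] at hy
    have h5 := hy.eq_zero hR
    have h6 := h5.2.1 0 ⟨le_rfl, hR.le⟩
    have h7 := h5.2.2.1 0 ⟨le_rfl, hR.le⟩
    simp only [p1, p2, q1, q2, mul_one, mul_zero, add_zero, zero_add] at h6 h7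
    rw [h6, h7]; rfl
  obtain ⟨⟨c, d⟩, hcd⟩ := (LinearMap.injective_iff_surjective.1 hinj) (-r₀ R, -r₁ R)
  simp only [Λ, LinearMap.coe_mk, AddHom.coe_mk, Prod.mk.injEq] at hcd
  have hs := ((hp.const_mul c).add (hq.const_mul d)).add hr
  obtain ⟨y, hy⟩ := hs.exists_isH3Representative
  refine ⟨y, (l : ℂ) • y - f, ⟨_, _, _, _, hy, by simp [p0, q0, r0], ?_, ?_, ?_⟩, by abel⟩
  · rw [hcd.1]; ring
  · rw [hcd.2]; ring
  · filter_upwards [hy.ae_eq, Lp.coeFn_smul (l : ℂ) y, Lp.coeFn_sub ((l : ℂ) • y) f] with x e1 e2 e3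
    rw [e3, Pi.sub_apply, e2, Pi.smul_apply, e1, smul_eq_mul]
    linear_combination hs.eqn x

theorem isMaximalDissipative_hnlsSubmodule (a b : ℝ) (hR : 0 < R) :
    IsMaximalDissipative (hnlsSubmodule a b hR) where
  dissipative y z h := by
    obtain ⟨y₀, y₁, y₂, y₃, h', _⟩ := id h
    have := two_mul_re_inner_eq hR h ⟨_, _, _, _, h', rfl⟩
    nlinarith [sq_nonneg ‖y₁ 0‖]
  surjective l hl f := exists_sub_eq a b hR hl f
  single_valued z h := by
    obtain ⟨y₀, y₁, y₂, y₃, h', _, _, _, hz⟩ := h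
    obtain ⟨_, h1, h2, h3⟩ := h'.eq_zero hR
    refine Lp.ext ?_
    have hI := ae_restrict_mem (μ := volume) (measurableSet_Ioo (a := (0 : ℝ)) (b := R))
    filter_upwards [hz, h3, hI, Lp.coeFn_zero ℂ 2 (volume.restrict (Ioo (0 : ℝ) R))]
      with x e1 e2 e3 e4
    rw [e4, e1, e2, h1 x (Ioo_subset_Icc_self e3), h2 x (Ioo_subset_Icc_self e3)]
    simp

end

/-! ### Compact contraction semigroups without conservative eigenvectors. -/

section Abstract

variable {H : Type*} [NormedAddCommGroup H] [InnerProductSpace ℂ H]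

/-- Freezing the orbit at negative times makes it continuous on the whole line, as two-sided
differentiation of its integrals requires. -/
theorem IsC0Semigroup.continuous_extend {S : ℝ → H →L[ℂ] H}
    (hS : IsC0Semigroup S) (x : H) :
    Continuous fun t : ℝ => S (max t 0) x :=
  (hS.continuousOn x).comp_continuous (by fun_prop) fun t => le_max_right t 0

variable [CompleteSpace H]

/-- Bounded sequences in a separable Hilbert space have weakly convergent subsequences. -/
theorem exists_weakly_convergent_subseq [TopologicalSpace.SeparableSpace H] {u : ℕ → H} {K : ℝ}
    (hu : ∀ n, ‖u n‖ ≤ K) : ∃ φ : ℕ → ℕ, StrictMono φ ∧ ∃ v : H, ∀ g : H,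
      Tendsto (fun n => inner ℂ g (u (φ n) - v)) atTop (𝓝 0) := by
  -- The sequence is moved to the dual by the Riesz map, where closed balls are weak-* sequentially
  -- compact.
  let L : ℕ → WeakDual ℂ H := fun n => StrongDual.toWeakDual (InnerProductSpace.toDual ℂ H (u n))
  have hL : ∀ n, L n ∈ WeakDual.toStrongDual ⁻¹' Metric.closedBall (0 : StrongDual ℂ H) K := by
    intro n
    simp only [L, mem_preimage, Metric.mem_closedBall, dist_zero_right]
    exact ((InnerProductSpace.toDual ℂ H).norm_map (u n)).trans_le (hu n)
  obtain ⟨l, -, φ, hφ, hl⟩ := WeakDual.isSeqCompact_closedBall ℂ H 0 K hL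
  refine ⟨φ, hφ, (InnerProductSpace.toDual ℂ H).symm (WeakDual.toStrongDual l), fun g => ?_⟩
  have h1 : Tendsto (fun n => L (φ n) g) atTop (𝓝 (l g)) :=
    ((WeakDual.eval_continuous g).tendsto l).comp hl
  have h2 : ∀ n, L (φ n) g = inner ℂ (u (φ n)) g := fun n => rfl
  have h3 : l g = inner ℂ ((InnerProductSpace.toDual ℂ H).symm (WeakDual.toStrongDual l)) g := by
    rw [InnerProductSpace.toDual_symm_apply]; rfl
  simp only [h2, h3] at h1
  have h4 := (Complex.continuous_conj.tendsto _).comp (h1.sub_const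
    (inner ℂ ((InnerProductSpace.toDual ℂ H).symm (WeakDual.toStrongDual l)) g))
  rw [sub_self, map_zero] at h4
  refine h4.congr fun n => ?_
  rw [Function.comp_apply, ← inner_sub_left, inner_conj_symm]

/-- The vectors on which a contraction `B` is isometric. -/
noncomputable def isometricSubspace (B : H →L[ℂ] H) : Submodule ℂ H :=
  LinearMap.ker ((1 - (ContinuousLinearMap.adjoint B).comp B : H →L[ℂ] H) : H →ₗ[ℂ] H)

/-- Expanding the square gives `‖x‖² - 2 ‖B x‖² + ‖B* B x‖²`, and `B*` is a contraction.
Near-isometry thus means `x ≈ B* B x`, a linear condition. -/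
theorem norm_sub_adjoint_apply_sq_le {B : H →L[ℂ] H} (hB : ∀ x, ‖B x‖ ≤ ‖x‖) (x : H) :
    ‖x - ContinuousLinearMap.adjoint B (B x)‖ ^ 2 ≤ ‖x‖ ^ 2 - ‖B x‖ ^ 2 := by
  have h1 : ‖ContinuousLinearMap.adjoint B (B x)‖ ≤ ‖B x‖ := by
    refine ((ContinuousLinearMap.adjoint B).le_of_opNorm_le ?_ (B x)).trans_eq (one_mul _)
    rw [LinearIsometryEquiv.norm_map]
    exact B.opNorm_le_bound zero_le_one fun x => by simpa using hB x
  have h2 := norm_sub_sq (𝕜 := ℂ) x (ContinuousLinearMap.adjoint B (B x))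
  rw [ContinuousLinearMap.adjoint_inner_right, inner_self_eq_norm_sq] at h2
  have h3 : ‖ContinuousLinearMap.adjoint B (B x)‖ ^ 2 ≤ ‖B x‖ ^ 2 :=
    pow_le_pow_left₀ (norm_nonneg _) h1 2
  linarith

theorem mem_isometricSubspace {B : H →L[ℂ] H} (hB : ∀ x, ‖B x‖ ≤ ‖x‖) {x : H} :
    x ∈ isometricSubspace B ↔ ‖B x‖ = ‖x‖ := by
  have e : x ∈ isometricSubspace B ↔ x - ContinuousLinearMap.adjoint B (B x) = 0 := Iff.rfl
  rw [e]
  constructor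
  · intro h
    have h1 : (inner ℂ x (x - ContinuousLinearMap.adjoint B (B x))) = 0 := by simp [h]
    rw [inner_sub_right, ContinuousLinearMap.adjoint_inner_right,
      inner_self_eq_norm_sq_to_K, inner_self_eq_norm_sq_to_K, sub_eq_zero] at h1
    have h2 : ‖x‖ ^ 2 = ‖B x‖ ^ 2 := by exact_mod_cast h1
    exact ((sq_eq_sq₀ (norm_nonneg _) (norm_nonneg _)).1 h2).symm
  · intro h
    have := norm_sub_adjoint_apply_sq_le hB x
    rw [h, sub_self] at this
    simpa using this.antisymm (by positivity)

/-- On this subspace `x = B* (B x)`, so compactness of `B` makes the closed unit ball compact. -/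
theorem finiteDimensional_isometricSubspace {B : H →L[ℂ] H}
    (hc : ∀ u : ℕ → H, (∀ n, ‖u n‖ ≤ 1) → ∃ φ : ℕ → ℕ, StrictMono φ ∧ ∃ v,
      Tendsto (fun n => B (u (φ n))) atTop (𝓝 v)) :
    FiniteDimensional ℂ (isometricSubspace B) := by
  refine FiniteDimensional.of_isCompact_closedBall ℂ one_pos (c := 0) ?_
  refine IsSeqCompact.isCompact fun u hu => ?_
  have hu' : ∀ n, ‖(u n : H)‖ ≤ 1 := fun n => by simpa using hu n
  obtain ⟨φ, hφ, v, hv⟩ := hc (fun n => u n) hu'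
  have h1 : Tendsto (fun n => (u (φ n) : H)) atTop (𝓝 (ContinuousLinearMap.adjoint B v)) := by
    refine (((ContinuousLinearMap.adjoint B).continuous.tendsto v).comp hv).congr fun n => ?_
    have : (u (φ n) : H) - ContinuousLinearMap.adjoint B (B (u (φ n))) = 0 := (u (φ n)).2
    exact (sub_eq_zero.1 this).symm
  have hcl : IsClosed (isometricSubspace B : Set H) :=
    (1 - (ContinuousLinearMap.adjoint B).comp B : H →L[ℂ] H).isClosed_ker
  have h2 : ContinuousLinearMap.adjoint B v ∈ isometricSubspace B :=
    hcl.mem_of_tendsto h1 (Eventually.of_forall fun n => (u (φ n)).2)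
  refine ⟨⟨_, h2⟩, ?_, φ, hφ, tendsto_subtype_rng.2 h1⟩
  simpa using le_of_tendsto h1.norm (Eventually.of_forall fun n => hu' (φ n))

/-- A compact contraction of norm one is isometric on some line. -/
theorem exists_isometric_vector {B : H →L[ℂ] H} (hB : ∀ x, ‖B x‖ ≤ ‖x‖)
    (hc : ∀ u : ℕ → H, (∀ n, ‖u n‖ ≤ 1) → ∃ φ : ℕ → ℕ, StrictMono φ ∧ ∃ v,
      Tendsto (fun n => B (u (φ n))) atTop (𝓝 v))
    (h : ¬ ∃ ρ : ℝ, 0 ≤ ρ ∧ ρ < 1 ∧ ∀ x, ‖B x‖ ≤ ρ * ‖x‖) : isometricSubspace B ≠ ⊥ := by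
  push Not at h
  have hρ : ∀ n : ℕ, (0 : ℝ) ≤ 1 - 1 / (n + 1) ∧ 1 - 1 / ((n : ℝ) + 1) < 1 := fun n => by
    have : (0 : ℝ) < 1 / (n + 1) := by positivity
    have : (1 : ℝ) / (n + 1) ≤ 1 := by
      rw [div_le_one (by positivity)]; linarith [(Nat.cast_nonneg n : (0 : ℝ) ≤ n)]
    constructor <;> linarith
  choose x hx using fun n : ℕ => h _ (hρ n).1 (hρ n).2
  have hx0 : ∀ n, 0 < ‖x n‖ := fun n => by
    rw [norm_pos_iff]
    intro h0
    have := hx n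
    simp [h0] at this
  let u : ℕ → H := fun n => ((‖x n‖⁻¹ : ℝ) : ℂ) • x n
  have hu : ∀ n, ‖u n‖ = 1 := fun n => by
    simp only [u]
    rw [norm_smul, Complex.norm_real, norm_inv, norm_norm, inv_mul_cancel₀ (hx0 n).ne']
  have hBu : ∀ n : ℕ, 1 - 1 / ((n : ℝ) + 1) ≤ ‖B (u n)‖ := fun n => by
    simp only [u]
    rw [map_smul, norm_smul, Complex.norm_real, norm_inv, norm_norm, inv_mul_eq_div,
      le_div_iff₀ (hx0 n)]
    exact (hx n).le
  have hBlim : Tendsto (fun n => ‖B (u n)‖) atTop (𝓝 1) := by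
    have h1 : Tendsto (fun n : ℕ => 1 - 1 / ((n : ℝ) + 1)) atTop (𝓝 (1 - 0)) :=
      tendsto_const_nhds.sub tendsto_one_div_add_atTop_nhds_zero_nat
    rw [sub_zero] at h1
    exact tendsto_of_tendsto_of_tendsto_of_le_of_le h1 tendsto_const_nhds hBu
      fun n => (hB _).trans_eq (hu n)
  have hlim : Tendsto (fun n => u n - ContinuousLinearMap.adjoint B (B (u n))) atTop (𝓝 0) := by
    rw [tendsto_zero_iff_norm_tendsto_zero]
    have h1 : Tendsto (fun n => Real.sqrt (1 - ‖B (u n)‖ ^ 2)) atTop (𝓝 0) := by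
      have := ((hBlim.pow 2).const_sub 1).sqrt
      simpa using this
    refine squeeze_zero (fun _ => norm_nonneg _) (fun n => Real.le_sqrt_of_sq_le ?_) h1
    have := norm_sub_adjoint_apply_sq_le hB (u n)
    rwa [hu, one_pow] at this
  obtain ⟨φ, hφ, v, hv⟩ := hc u fun n => (hu n).le
  -- Since `u - B* B u → 0`, convergence of `B u` forces convergence of `u` itself, so the supremum
  -- is attained at `B* v`.
  have h1 : Tendsto (fun n => u (φ n)) atTop (𝓝 (ContinuousLinearMap.adjoint B v)) := by
    have := (hlim.comp hφ.tendsto_atTop).add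
      (((ContinuousLinearMap.adjoint B).continuous.tendsto v).comp hv)
    rw [zero_add] at this
    exact this.congr fun n => by simp
  have h2 : ‖ContinuousLinearMap.adjoint B v‖ = 1 :=
    tendsto_nhds_unique h1.norm (by simp [hu])
  have h3 : ‖B (ContinuousLinearMap.adjoint B v)‖ = 1 :=
    tendsto_nhds_unique ((B.continuous.tendsto _).comp h1).norm (hBlim.comp hφ.tendsto_atTop)
  intro hbot
  have h4 : ContinuousLinearMap.adjoint B v ∈ isometricSubspace B :=
    (mem_isometricSubspace hB).2 (h3.trans h2.symm)
  rw [hbot, Submodule.mem_bot] at h4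
  rw [h4, norm_zero] at h2
  exact zero_ne_one h2

variable {G : Submodule ℂ (H × H)} {S : ℝ → H →L[ℂ] H}

/-- Time averages of an orbit belong to the domain of the generator. -/
theorem IsGeneratorGraph.integral_mem (hA : IsGeneratorGraph S (fun x y => (x, y) ∈ G))
    (hS : IsC0Semigroup S) (x : H) {h : ℝ} (hh : 0 ≤ h) :
    (∫ s in (0 : ℝ)..h, S (max s 0) x, S h x - x) ∈ G := by
  refine (hA _ _).2 ?_
  have hf := hS.continuous_extend x
  set f : ℝ → H := fun s => S (max s 0) x with hfdef
  have hi : ∀ p q, IntervalIntegrable f volume p q := fun p q => hf.intervalIntegrable p q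
  have hF : ∀ τ, HasDerivAt (fun τ => ∫ s in (0 : ℝ)..τ, f s) (f τ) τ := fun τ =>
    intervalIntegral.integral_hasDerivAt_right (hi _ _)
      hf.aestronglyMeasurable.stronglyMeasurableAtFilter hf.continuousAt
  -- `S(r)` shifts the window of integration, so the difference quotient is that of `r ↦ ∫ over [r,
  -- h + r]`.
  have hd : HasDerivAt (fun r => (∫ s in (0 : ℝ)..(h + r), f s) - ∫ s in (0 : ℝ)..r, f s)
      (f h - f 0) 0 := by
    have h1 : HasDerivAt (fun τ => ∫ s in (0 : ℝ)..τ, f s) (f h) (h + 0) := by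
      rw [add_zero]; exact hF h
    exact (h1.comp_const_add h 0).sub (hF 0)
  have h0 : f h - f 0 = S h x - x := by
    simp [hfdef, max_eq_left hh, hS.zero]
  rw [h0] at hd
  have := (hasDerivAt_iff_tendsto_slope.1 hd).mono_left
    (nhdsWithin_mono 0 (fun r (hr : r ∈ Ioi (0 : ℝ)) => (mem_Ioi.1 hr).ne'))
  refine this.congr' ?_
  filter_upwards [self_mem_nhdsWithin] with r hr
  have hr0 : (0 : ℝ) ≤ r := le_of_lt hr
  simp only [slope, vsub_eq_sub, sub_zero, add_zero, intervalIntegral.integral_same]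
  rw [← Complex.ofReal_inv, Complex.coe_smul]
  congr 1
  have e1 : S r (∫ s in (0 : ℝ)..h, f s) = ∫ s in (0 : ℝ)..h, f (s + r) := by
    rw [← ContinuousLinearMap.intervalIntegral_comp_comm _ (hi _ _)]
    refine intervalIntegral.integral_congr fun s hs => ?_
    rw [uIcc_of_le hh] at hs
    simp only [hfdef]
    rw [max_eq_left hs.1, max_eq_left (add_nonneg hs.1 hr0), add_comm s r, hS.add r s hr0 hs.1]
    rfl
  rw [e1, intervalIntegral.integral_comp_add_right, zero_add,
    intervalIntegral.integral_interval_sub_left (hi _ _) (hi _ _)]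

/-- On an invariant finite-dimensional space of short-time orbits, the generator is defined
everywhere and has an eigenvector. -/
theorem IsGeneratorGraph.exists_eigenvector (hG : IsMaximalDissipative G)
    (hA : IsGeneratorGraph S (fun x y => (x, y) ∈ G)) (hS : IsC0Semigroup S)
    (N : Submodule ℂ H) [FiniteDimensional ℂ N] (hN : N ≠ ⊥) {δ : ℝ} (hδ : 0 < δ)
    (hinv : ∀ s, 0 ≤ s → s < δ → ∀ x ∈ N, S s x ∈ N) :
    ∃ y ∈ N, y ≠ 0 ∧ ∃ l : ℂ, (y, l • y) ∈ G := by
  have hNc : IsClosed (N : Set H) := N.closed_of_finiteDimensional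
  have hev : ∀ᶠ r in 𝓝[>] (0 : ℝ), 0 < r ∧ r < δ := by
    filter_upwards [Ioo_mem_nhdsGT hδ] with r hr using hr
  have hgen : ∀ x ∈ N, ∀ y, (x, y) ∈ G → y ∈ N := by
    intro x hx y hxy
    refine hNc.mem_of_tendsto ((hA x y).1 hxy) ?_
    filter_upwards [hev] with r hr
    exact N.smul_mem _ (N.sub_mem (hinv r hr.1.le hr.2 x hx) hx)
  -- `D` is closed, being finite-dimensional, and contains the short-time averages of orbits from
  -- `N`. These averages converge to their starting points, so `D = N`.
  let D : Submodule ℂ H := G.map (LinearMap.fst ℂ H H) ⊓ N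
  have hDfin : FiniteDimensional ℂ D := Submodule.finiteDimensional_inf_right _ _
  have hD : ∀ x ∈ N, ∃ y, (x, y) ∈ G := by
    intro x hx
    have hf := hS.continuous_extend x
    have h1 : HasDerivAt (fun τ => ∫ s in (0 : ℝ)..τ, S (max s 0) x) (S (max 0 0) x) 0 :=
      intervalIntegral.integral_hasDerivAt_right (hf.intervalIntegrable _ _)
        hf.aestronglyMeasurable.stronglyMeasurableAtFilter hf.continuousAt
    have h2 := (hasDerivAt_iff_tendsto_slope.1 h1).mono_left
      (nhdsWithin_mono 0 (fun r (hr : r ∈ Ioi (0 : ℝ)) => (mem_Ioi.1 hr).ne'))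
    rw [max_self, hS.zero, ContinuousLinearMap.id_apply] at h2
    have h3 : x ∈ D := by
      refine D.closed_of_finiteDimensional.mem_of_tendsto h2 ?_
      filter_upwards [hev] with r hr
      simp only [slope, vsub_eq_sub, sub_zero, intervalIntegral.integral_same]
      rw [← Complex.coe_smul]
      refine D.smul_mem _ ⟨?_, ?_⟩
      · simp only [SetLike.mem_coe, Submodule.mem_map]
        exact ⟨_, hA.integral_mem hS x hr.1.le, rfl⟩
      -- The average stays in `N`: the projection onto the orthogonal complement passes under the
      -- integral and kills the integrand.
      · have h4 : (N.orthogonal.orthogonalProjectionOnto) (∫ s in (0 : ℝ)..r, S (max s 0) x) = 0 := by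
          rw [← ContinuousLinearMap.intervalIntegral_comp_comm _ (hf.intervalIntegrable _ _)]
          refine (intervalIntegral.integral_congr (g := fun _ => 0) fun s hs => ?_).trans (by simp)
          rw [uIcc_of_le hr.1.le] at hs
          rw [Submodule.orthogonalProjectionOnto_eq_zero_iff]
          refine Submodule.le_orthogonal_orthogonal N ?_
          rw [max_eq_left hs.1]
          exact hinv s hs.1 (hs.2.trans_lt hr.2) x hx
        rw [Submodule.orthogonalProjectionOnto_eq_zero_iff, Submodule.orthogonal_orthogonal] at h4
        exact h4
    obtain ⟨⟨p, y⟩, hp, rfl⟩ := Submodule.mem_map.1 h3.1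
    exact ⟨y, hp⟩
  choose Y hY using fun x : N => hD x x.2
  let A : N →ₗ[ℂ] N :=
    { toFun := fun x => ⟨Y x, hgen x x.2 _ (hY x)⟩
      map_add' := fun x y => Subtype.ext
        (hG.eq_of_mem (hY (x + y)) (G.add_mem (hY x) (hY y)))
      map_smul' := fun c x => Subtype.ext
        (hG.eq_of_mem (hY (c • x)) (G.smul_mem c (hY x))) }
  have : Nontrivial N := Submodule.nontrivial_iff_ne_bot.2 hN
  obtain ⟨l, hl⟩ := Module.End.exists_eigenvalue A
  obtain ⟨v, hv⟩ := hl.exists_hasEigenvector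
  refine ⟨v, v.2, fun h0 => hv.2 (Subtype.ext h0), l, ?_⟩
  have h1 : Y v = l • (v : H) := congrArg Subtype.val hv.apply_eq_smul
  rw [← h1]
  exact hY v

/-- A contraction semigroup which is compact for positive times and whose generator has no
conservative eigenvector is a strict contraction for positive times. -/
theorem IsGeneratorGraph.exists_norm_le_mul (hG : IsMaximalDissipative G)
    (hA : IsGeneratorGraph S (fun x y => (x, y) ∈ G)) (hS : IsC0Semigroup S)
    (hc : ∀ t, 0 < t → ∀ u : ℕ → H, (∀ n, ‖u n‖ ≤ 1) → ∃ φ : ℕ → ℕ, StrictMono φ ∧ ∃ v,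
      Tendsto (fun n => S t (u (φ n))) atTop (𝓝 v))
    (hU : ∀ (y : H) (l : ℂ), (y, l • y) ∈ G → (inner ℂ (l • y) y).re = 0 → y = 0)
    {T : ℝ} (hT : 0 < T) : ∃ ρ : ℝ, 0 ≤ ρ ∧ ρ < 1 ∧ ∀ x, ‖S T x‖ ≤ ρ * ‖x‖ := by
  by_contra hcon
  have hle : ∀ t, 0 ≤ t → ∀ x, ‖S t x‖ ≤ ‖x‖ := fun t ht x => hA.norm_apply_le hG hS ht x
  have hNT := exists_isometric_vector (hle T hT.le) (hc T hT) hcon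
  have hfin : ∀ t, 0 < t → FiniteDimensional ℂ (isometricSubspace (S t)) := fun t ht =>
    finiteDimensional_isometricSubspace (hc t ht)
  -- Equality of the outer terms in `‖S(t) S(s) x‖ ≤ ‖S(s) x‖ ≤ ‖x‖` forces equality throughout.
  have hshift : ∀ s t, 0 ≤ s → 0 ≤ t → ∀ x ∈ isometricSubspace (S (t + s)),
      x ∈ isometricSubspace (S s) ∧ S s x ∈ isometricSubspace (S t) := by
    intro s t hs ht x hx
    rw [mem_isometricSubspace (hle _ (add_nonneg ht hs)), hS.add t s ht hs,
      ContinuousLinearMap.comp_apply] at hx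
    rw [mem_isometricSubspace (hle s hs), mem_isometricSubspace (hle t ht)]
    have h1 := hle t ht (S s x)
    have h2 := hle s hs x
    constructor <;> linarith
  have hanti : ∀ s t, 0 ≤ s → s ≤ t → isometricSubspace (S t) ≤ isometricSubspace (S s) := by
    intro s t hs hst x hx
    refine (hshift s (t - s) hs (sub_nonneg.2 hst) x ?_).1
    rwa [sub_add_cancel]
  -- Minimal dimension over the open interval is attained at some `t < T`, which leaves room `T - t`
  -- for shifts during which the space cannot shrink.
  let dims : Set ℕ := {n | ∃ t ∈ Ioo 0 T, Module.finrank ℂ (isometricSubspace (S t)) = n}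
  have hdims : dims.Nonempty := ⟨_, T / 2, ⟨by linarith, by linarith⟩, rfl⟩
  obtain ⟨t, ht, hmin⟩ := Nat.sInf_mem hdims
  have := hfin t ht.1
  have heq : ∀ s, t ≤ s → s < T → isometricSubspace (S s) = isometricSubspace (S t) := by
    intro s hts hsT
    refine Submodule.eq_of_le_of_finrank_le (hanti t s ht.1.le hts) ?_
    rw [hmin]
    exact Nat.sInf_le ⟨s, ⟨ht.1.trans_le hts, hsT⟩, rfl⟩
  have hne : isometricSubspace (S t) ≠ ⊥ := fun h =>
    hNT (le_bot_iff.1 ((hanti t T ht.1.le ht.2.le).trans_eq h))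
  obtain ⟨y, hy, hy0, l, hl⟩ := hA.exists_eigenvector hG hS (isometricSubspace (S t)) hne
    (sub_pos.2 ht.2) (fun s hs hsδ x hx => by
      refine (hshift s t hs ht.1.le x ?_).2
      rwa [heq (t + s) (by linarith) (by linarith)])
  refine hy0 (hU y l hl ?_)
  -- The norm is constant along this orbit on `[0, t)`, so its right derivative at `0`, which is `2
  -- Re ⟨l y, y⟩`, vanishes.
  have h1 := hasDerivWithinAt_norm_sq_complex (hA.hasDerivWithinAt hS hl le_rfl)
  have h2 : HasDerivWithinAt (fun r => ‖S r y‖ ^ 2) 0 (Ici 0) 0 := by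
    refine (hasDerivWithinAt_const (0 : ℝ) (Ici 0) (‖y‖ ^ 2)).congr_of_eventuallyEq ?_
      (by simp [hS.zero])
    filter_upwards [self_mem_nhdsWithin, mem_nhdsWithin_of_mem_nhds (Iio_mem_nhds ht.1)] with r h3 h4
    rw [(mem_isometricSubspace (hle r h3)).1 (hanti r t h3 (le_of_lt h4) hy)]
  have h3 := (uniqueDiffWithinAt_Ici (0 : ℝ)).eq_deriv _ h1 h2
  rw [hS.zero] at h3
  simpa using h3

/-- Kato smoothing with respect to a symmetric operator `M`, measured by an operator `V` that maps
weakly null sequences to null sequences, makes the semigroup compact. -/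
theorem IsGeneratorGraph.tendsto_zero_of_weakly_null (hG : IsMaximalDissipative G)
    (hA : IsGeneratorGraph S (fun x y => (x, y) ∈ G)) (hS : IsC0Semigroup S)
    {M V : H →L[ℂ] H} {C : ℝ} (hM : ∀ x y, inner ℂ (M x) y = inner ℂ x (M y))
    (hK : ∀ x y, (x, y) ∈ G → ∀ ε > 0,
      ‖x‖ ^ 2 ≤ ε * (C * ‖x‖ ^ 2 - 2 * (inner ℂ (M x) y).re) + 1 / ε * ‖V x‖ ^ 2)
    (hV : ∀ w : ℕ → H, (∃ K, ∀ n, ‖w n‖ ≤ K) → (∀ g, Tendsto (fun n => inner ℂ g (w n)) atTop (𝓝 0)) →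
      Tendsto (fun n => V (w n)) atTop (𝓝 0))
    {T : ℝ} (hT : 0 < T) {w : ℕ → H} (hw : ∃ K, ∀ n, ‖w n‖ ≤ K)
    (hw0 : ∀ g, Tendsto (fun n => inner ℂ g (w n)) atTop (𝓝 0)) :
    Tendsto (fun n => S T (w n)) atTop (𝓝 0) := by
  obtain ⟨K₀, hK₀⟩ := hw
  have hle : ∀ t, 0 ≤ t → ∀ x, ‖S t x‖ ≤ ‖x‖ := fun t ht x => hA.norm_apply_le hG hS ht x
  have hpos : ∀ n : ℕ, (0 : ℝ) < 1 / (n + 1) := fun n => by positivity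
  have hlim := tendsto_one_div_add_atTop_nhds_zero_nat (𝕜 := ℝ)
  -- Approximants in the domain at distance below `1 / (n + 1)` keep the sequence bounded and weakly
  -- null.
  choose w' hw' hd using fun n : ℕ => hG.dense.exists_dist_lt (w n) (hpos n)
  choose z hz using hw'
  simp only [dist_eq_norm] at hd
  set K := K₀ + 1 with hKdef
  have hK' : ∀ n, ‖w' n‖ ≤ K := fun n => by
    have h1 : (1 : ℝ) / (n + 1) ≤ 1 := by
      rw [div_le_one (by positivity)]; linarith [(Nat.cast_nonneg n : (0 : ℝ) ≤ n)]
    have h2 := norm_sub_le (w n) (w n - w' n)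
    rw [sub_sub_cancel] at h2
    linarith [hK₀ n, hd n]
  have hK0 : 0 ≤ K := (norm_nonneg _).trans (hK' 0)
  have hweak : ∀ g, Tendsto (fun n => inner ℂ g (w' n)) atTop (𝓝 0) := by
    intro g
    have h1 : Tendsto (fun n => inner ℂ g (w n - w' n)) atTop (𝓝 0) := by
      rw [tendsto_zero_iff_norm_tendsto_zero]
      refine squeeze_zero (fun _ => norm_nonneg _)
        (fun n => (norm_inner_le_norm _ _).trans
          (mul_le_mul_of_nonneg_left (hd n).le (norm_nonneg g))) ?_
      simpa using hlim.const_mul ‖g‖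
    have h2 := (hw0 g).sub h1
    rw [sub_zero] at h2
    exact h2.congr fun n => by rw [inner_sub_right, sub_sub_cancel]
  have hcont : ∀ x, ContinuousOn (fun s => S s x) (uIcc 0 T) := fun x => by
    rw [uIcc_of_le hT.le]; exact IsGeneratorGraph.continuousOn_orbit hS x T
  have hVc : ∀ n, ContinuousOn (fun s => ‖V (S s (w' n))‖ ^ 2) (uIcc 0 T) := fun n =>
    (V.continuous.comp_continuousOn (hcont _)).norm.pow 2
  -- Bounded operators `S(s)` preserve weak nullity, so the integrand tends to zero pointwise and is
  -- dominated by a constant.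
  have hI : Tendsto (fun n => ∫ s in (0 : ℝ)..T, ‖V (S s (w' n))‖ ^ 2) atTop (𝓝 0) := by
    have := intervalIntegral.tendsto_integral_filter_of_dominated_convergence (μ := volume)
      (a := 0) (b := T) (l := atTop) (F := fun n s => ‖V (S s (w' n))‖ ^ 2) (f := fun _ => (0 : ℝ))
      (fun _ => (‖V‖ * K) ^ 2)
      (Eventually.of_forall fun n => ((hVc n).mono uIoc_subset_uIcc).aestronglyMeasurable
        measurableSet_uIoc)
      (Eventually.of_forall fun n => Eventually.of_forall fun s hs => by
        rw [uIoc_of_le hT.le] at hs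
        rw [Real.norm_of_nonneg (by positivity)]
        exact pow_le_pow_left₀ (norm_nonneg _) ((V.le_opNorm _).trans
          (mul_le_mul_of_nonneg_left ((hle s hs.1.le _).trans (hK' n)) (norm_nonneg _))) 2)
      intervalIntegrable_const
      (Eventually.of_forall fun s hs => by
        rw [uIoc_of_le hT.le] at hs
        have h1 := hV (fun n => S s (w' n)) ⟨K, fun n => (hle s hs.1.le _).trans (hK' n)⟩
          (fun g => (hweak (ContinuousLinearMap.adjoint (S s) g)).congr fun n => by
            rw [ContinuousLinearMap.adjoint_inner_left])
        simpa using h1.norm.pow 2)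
    simpa using this
  set A := |C| * K ^ 2 * T + 2 * (‖M‖ * K ^ 2) with hAdef
  have hA0 : 0 ≤ A := by positivity
  have hquad : ∀ x, ‖x‖ ≤ K → |(inner ℂ (M x) x).re| ≤ ‖M‖ * K ^ 2 := by
    intro x hx
    refine (Complex.abs_re_le_norm _).trans ((norm_inner_le_norm _ _).trans ?_)
    have h1 := M.le_opNorm x
    calc ‖M x‖ * ‖x‖ ≤ (‖M‖ * K) * K := by
          gcongr
          exact h1.trans (mul_le_mul_of_nonneg_left hx (norm_nonneg _))
      _ = ‖M‖ * K ^ 2 := by ring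
  -- The hypothesis `hK` is integrated along the orbit. The term `2 Re ⟨M u, A u⟩` integrates to
  -- endpoint values of `Re ⟨M u, u⟩`, and `‖S(T) w‖ ≤ ‖S(s) w‖` bounds the left side.
  have hbound : ∀ n, ∀ ε > 0, T * ‖S T (w' n)‖ ^ 2 ≤
      ε * A + 1 / ε * ∫ s in (0 : ℝ)..T, ‖V (S s (w' n))‖ ^ 2 := by
    intro n ε hε
    have e1 := hA.integral_re_inner hS M (hz n) hT.le
    have e2 : ∀ s, (inner ℂ (M (S s (w' n))) (S s (z n))).re +
        (inner ℂ (M (S s (z n))) (S s (w' n))).re =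
        2 * (inner ℂ (M (S s (w' n))) (S s (z n))).re := fun s => by
      rw [hM (S s (z n)), two_mul]
      congr 1
      exact inner_re_symm (𝕜 := ℂ) _ _
    simp only [e2] at e1
    have q1 := abs_le.1 (hquad _ ((hle T hT.le _).trans (hK' n)))
    have q2 := abs_le.1 (hquad _ (hK' n))
    have i1 : IntervalIntegrable (fun s => 2 * (inner ℂ (M (S s (w' n))) (S s (z n))).re)
        volume 0 T :=
      ((Complex.continuous_re.comp_continuousOn ((M.continuous.comp_continuousOn
        (hcont (w' n))).inner (𝕜 := ℂ) (hcont (z n)))).const_mul 2).intervalIntegrable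
    have i2 : IntervalIntegrable (fun s => ‖V (S s (w' n))‖ ^ 2) volume 0 T :=
      (hVc n).intervalIntegrable
    have i3 : IntervalIntegrable (fun s => ε * (|C| * K ^ 2 -
        2 * (inner ℂ (M (S s (w' n))) (S s (z n))).re)) volume 0 T :=
      (intervalIntegrable_const.sub i1).const_mul ε
    have hmono : ∫ _ in (0 : ℝ)..T, ‖S T (w' n)‖ ^ 2 ≤ ∫ s in (0 : ℝ)..T,
        (ε * (|C| * K ^ 2 - 2 * (inner ℂ (M (S s (w' n))) (S s (z n))).re) +
          1 / ε * ‖V (S s (w' n))‖ ^ 2) := by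
      refine intervalIntegral.integral_mono_on hT.le intervalIntegrable_const
        (i3.add (i2.const_mul _)) fun s hs => ?_
      have h1 := hK _ _ (hA.mem hS (hz n) hs.1) ε hε
      have h2 : ‖S T (w' n)‖ ≤ ‖S s (w' n)‖ := by
        have := hS.add (T - s) s (sub_nonneg.2 hs.2) hs.1
        rw [sub_add_cancel] at this
        rw [this]
        exact hle _ (sub_nonneg.2 hs.2) _
      have h3 : ‖S s (w' n)‖ ≤ K := (hle s hs.1 _).trans (hK' n)
      have h4 : C * ‖S s (w' n)‖ ^ 2 ≤ |C| * K ^ 2 :=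
        mul_le_mul (le_abs_self C) (pow_le_pow_left₀ (norm_nonneg _) h3 2) (by positivity)
          (abs_nonneg C)
      have h5 := pow_le_pow_left₀ (norm_nonneg _) h2 2
      have h6 := mul_le_mul_of_nonneg_left h4 hε.le
      linarith
    rw [intervalIntegral.integral_add i3 (i2.const_mul _), intervalIntegral.integral_const_mul,
      intervalIntegral.integral_const_mul, intervalIntegral.integral_sub intervalIntegrable_const i1,
      intervalIntegral.integral_const, intervalIntegral.integral_const, e1] at hmono
    simp only [sub_zero, smul_eq_mul] at hmono
    refine hmono.trans ?_
    gcongr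
    rw [hAdef]
    linarith
  have hmain : Tendsto (fun n => ‖S T (w' n)‖ ^ 2) atTop (𝓝 0) := by
    rw [Metric.tendsto_atTop]
    intro η hη
    set ε := η * T / (2 * (A + 1)) with hεdef
    have hε : 0 < ε := by positivity
    obtain ⟨N, hN⟩ := Metric.tendsto_atTop.1 hI (ε * (η * T / 2)) (by positivity)
    refine ⟨N, fun n hn => ?_⟩
    have h1 := hN n hn
    have h2 := hbound n ε hε
    rw [Real.dist_eq, sub_zero] at h1 ⊢
    have h3 := (le_abs_self _).trans_lt h1
    have h4 : 1 / ε * ∫ s in (0 : ℝ)..T, ‖V (S s (w' n))‖ ^ 2 < η * T / 2 := by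
      rw [one_div, inv_mul_lt_iff₀ hε]; exact h3
    have h5 : ε * A ≤ η * T / 2 := by
      have : ε * (A + 1) = η * T / 2 := by rw [hεdef]; field_simp
      linarith
    rw [abs_of_nonneg (by positivity)]
    have h6 : T * ‖S T (w' n)‖ ^ 2 < T * η := by linarith
    exact lt_of_mul_lt_mul_left h6 hT.le
  have hmain' : Tendsto (fun n => ‖S T (w' n)‖ + 1 / ((n : ℝ) + 1)) atTop (𝓝 0) := by
    have := hmain.sqrt
    simp only [Real.sqrt_sq (norm_nonneg _), Real.sqrt_zero] at this
    simpa using this.add hlim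
  rw [tendsto_zero_iff_norm_tendsto_zero]
  refine squeeze_zero (fun _ => norm_nonneg _) (fun n => ?_) hmain'
  have h1 : S T (w n) = S T (w' n) + S T (w n - w' n) := by rw [map_sub]; abel
  rw [h1]
  exact (norm_add_le _ _).trans (add_le_add_right ((hle T hT.le _).trans (hd n).le) _)

end Abstract

/-! ### Eigenfunctions with zero trace and critical lengths. -/

section

variable {R : ℝ}

theorem HasACDeriv.eq_of_deriv_zero {F : ℝ → ℂ} (hF : HasACDeriv R F (fun _ => 0)) {x : ℝ}
    (hx : x ∈ Icc (0 : ℝ) R) : F x = F 0 := by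
  simpa using hF.isPrimitiveOn x hx

/-- Variation of constants for `v' = m v + c e^{m x}`. -/
theorem HasACDeriv.eq_resonant (hR : 0 ≤ R) {v w : ℝ → ℂ} {m c : ℂ} (hv : HasACDeriv R v w)
    (hw : ∀ᵐ x ∂volume.restrict (Ioo (0 : ℝ) R), w x = m * v x + c * Complex.exp (m * x))
    {x : ℝ} (hx : x ∈ Icc (0 : ℝ) R) : v x = Complex.exp (m * x) * (v 0 + c * x) := by
  have hid : HasACDeriv R (fun x : ℝ => (x : ℂ)) (fun _ => 1) :=
    .of_hasDerivAt (fun x => Complex.ofRealCLM.hasDerivAt) continuous_const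
  have h1 := ((hasACDeriv_exp (-m)).mul hR (hv.congr_deriv hR hw)).sub (hid.const_mul c)
  have he : ∀ x : ℝ, Complex.exp (-m * x) * Complex.exp (m * x) = 1 := fun x => by
    rw [← Complex.exp_add]; simp
  have h2 := (h1.congr_deriv (g := fun _ => 0) hR (Eventually.of_forall fun s => by
    linear_combination c * he s)).eq_of_deriv_zero hx
  simp only [Complex.ofReal_zero, mul_zero, Complex.exp_zero, one_mul, sub_zero] at h2
  linear_combination Complex.exp (m * x) * h2 - v x * he x

theorem HasACDeriv.eq_exp (hR : 0 ≤ R) {v w : ℝ → ℂ} {m : ℂ} (hv : HasACDeriv R v w)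
    (hw : ∀ᵐ x ∂volume.restrict (Ioo (0 : ℝ) R), w x = m * v x)
    {x : ℝ} (hx : x ∈ Icc (0 : ℝ) R) : v x = Complex.exp (m * x) * v 0 := by
  have := hv.eq_resonant hR (c := 0) (hw.mono fun x h => by rw [h]; ring) hx
  simpa using this

/-- Third order equations with vanishing Cauchy data at both ends, except for the second
derivatives: relations satisfied by the roots of the characteristic polynomial. -/
theorem characteristic_relations (hR : 0 < R) {y₀ y₁ y₂ y₃ : ℝ → ℂ} {m₁ m₂ m₃ : ℂ}
    (h0 : HasACDeriv R y₀ y₁) (h1 : HasACDeriv R y₁ y₂) (h2 : HasACDeriv R y₂ y₃)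
    (heq : ∀ᵐ x ∂volume.restrict (Ioo (0 : ℝ) R), y₃ x = (m₁ + m₂ + m₃) * y₂ x -
      (m₁ * m₂ + m₁ * m₃ + m₂ * m₃) * y₁ x + m₁ * m₂ * m₃ * y₀ x)
    (e0 : y₀ 0 = 0) (e1 : y₁ 0 = 0) (e0' : y₀ R = 0) (e1' : y₁ R = 0) :
    y₂ R = Complex.exp (m₁ * R) * y₂ 0 ∧ (m₁ = m₂ → y₂ 0 = 0) ∧
      (y₂ 0 = 0 → ∀ x ∈ Icc (0 : ℝ) R, y₀ x = 0) := by
  -- The function `v = (D - m₂)(D - m₃) y` solves `v' = m₁ v` and equals `y''` at both ends.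
  have hv := (h2.sub (h1.const_mul (m₂ + m₃))).add (h0.const_mul (m₂ * m₃))
  have hg := h1.sub (h0.const_mul m₃)
  have hvx : ∀ x ∈ Icc (0 : ℝ) R, y₂ x - (m₂ + m₃) * y₁ x + m₂ * m₃ * y₀ x =
      Complex.exp (m₁ * x) * y₂ 0 := fun x hx => by
    have := hv.eq_exp (m := m₁) hR.le (heq.mono fun x h => by rw [h]; ring) hx
    simpa [e0, e1] using this
  have hRm : R ∈ Icc (0 : ℝ) R := ⟨hR.le, le_rfl⟩
  have hI := ae_restrict_mem (μ := volume) (measurableSet_Ioo (a := (0 : ℝ)) (b := R))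
  refine ⟨by simpa [e0', e1'] using hvx R hRm, fun hm => ?_, fun hα => ?_⟩
  · subst hm
    -- For `m₁ = m₂` the equation for `g = y' - m₃ y` is resonant, giving `g(R) = R e^{m₁ R}
    -- y''(0)`, while the end data give `g(R) = 0`.
    have := hg.eq_resonant (m := m₁) (c := y₂ 0) hR.le (hI.mono fun x hx => by
      linear_combination hvx x (Ioo_subset_Icc_self hx)) hRm
    simp only [e0, e1, e0', e1', mul_zero, sub_zero, zero_add] at this
    have h3 := (mul_eq_zero.1 this.symm).resolve_left (Complex.exp_ne_zero _)
    exact (mul_eq_zero.1 h3).resolve_right (by exact_mod_cast hR.ne')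
  · have h3 : ∀ x ∈ Icc (0 : ℝ) R, y₁ x - m₃ * y₀ x = 0 := fun x hx => by
      have := hg.eq_exp (m := m₂) hR.le (hI.mono fun x hx => by
        have := hvx x (Ioo_subset_Icc_self hx)
        rw [hα, mul_zero] at this
        linear_combination this) hx
      simpa [e0, e1] using this
    intro x hx
    have := h0.eq_exp (m := m₃) hR.le (hI.mono fun x hx => by
      linear_combination h3 x (Ioo_subset_Icc_self hx)) hx
    simpa [e0] using this

/-- The form takes the same value on any two of `j`, `k`, `-(j + k)`. These sum to zero, so two of
them share a sign. -/
theorem exists_pos_quadratic_form_eq {j k : ℤ} (hj : j ≠ 0) (hk : k ≠ 0) (hjk : j + k ≠ 0) :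
    ∃ p q : ℕ, 1 ≤ p ∧ 1 ≤ q ∧ (p : ℤ) ^ 2 + p * q + q ^ 2 = j ^ 2 + j * k + k ^ 2 := by
  have key : ∀ u v : ℤ, 0 < u → 0 < v → u ^ 2 + u * v + v ^ 2 = j ^ 2 + j * k + k ^ 2 →
      ∃ p q : ℕ, 1 ≤ p ∧ 1 ≤ q ∧ (p : ℤ) ^ 2 + p * q + q ^ 2 = j ^ 2 + j * k + k ^ 2 := by
    intro u v hu hv h
    refine ⟨u.toNat, v.toNat, by omega, by omega, ?_⟩
    rw [Int.toNat_of_nonneg hu.le, Int.toNat_of_nonneg hv.le, h]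
  rcases lt_or_gt_of_ne hj with h1 | h1 <;> rcases lt_or_gt_of_ne hk with h2 | h2
  · exact key (-j) (-k) (by omega) (by omega) (by ring)
  · rcases lt_or_gt_of_ne hjk with h3 | h3
    · exact key k (-j - k) (by omega) (by omega) (by ring)
    · exact key (-j) (j + k) (by omega) (by omega) (by ring)
  · rcases lt_or_gt_of_ne hjk with h3 | h3
    · exact key j (-j - k) (by omega) (by omega) (by ring)
    · exact key (-k) (j + k) (by omega) (by omega) (by ring)
  · exact key j k h1 h2 rfl

/-- If three distinct roots `m₁, m₂, m₃` with `Σ mᵢ = i a`, `Σ mᵢ mⱼ = b` have equal exponentials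
`e^{mᵢ R}`, then the length `R` is critical. -/
theorem critical_length_of_exp_eq (hR : 0 < R) {a b : ℝ} {m₁ m₂ m₃ : ℂ}
    (hp : m₁ + m₂ + m₃ = Complex.I * a) (hq : m₁ * m₂ + m₁ * m₃ + m₂ * m₃ = b)
    (h12 : m₁ ≠ m₂) (h23 : m₂ ≠ m₃) (h13 : m₁ ≠ m₃)
    (e12 : Complex.exp (m₁ * R) = Complex.exp (m₂ * R))
    (e23 : Complex.exp (m₂ * R) = Complex.exp (m₃ * R)) :
    0 < 3 * b + a ^ 2 ∧ ∃ k l : ℕ, 1 ≤ k ∧ 1 ≤ l ∧ R = 2 * Real.pi *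
      Real.sqrt (((k : ℝ) ^ 2 + (k : ℝ) * (l : ℝ) + (l : ℝ) ^ 2) / (3 * b + a ^ 2)) := by
  obtain ⟨j, hj⟩ := Complex.exp_eq_exp_iff_exists_int.1 e12
  obtain ⟨k, hk⟩ := Complex.exp_eq_exp_iff_exists_int.1 e23
  have hRc : (R : ℂ) ≠ 0 := by exact_mod_cast hR.ne'
  have hj0 : j ≠ 0 := by
    rintro rfl
    exact h12 (mul_right_cancel₀ hRc (by simpa using hj))
  have hk0 : k ≠ 0 := by
    rintro rfl
    exact h23 (mul_right_cancel₀ hRc (by simpa using hk))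
  have hjk0 : j + k ≠ 0 := by
    intro h
    refine h13 (mul_right_cancel₀ hRc ?_)
    have : (j : ℂ) + k = 0 := by exact_mod_cast h
    linear_combination hj + hk + this * (2 * Real.pi * Complex.I)
  obtain ⟨p, q, hp1, hq1, hpq⟩ := exists_pos_quadratic_form_eq hj0 hk0 hjk0
  have hpq' : ((p : ℂ) ^ 2 + p * q + q ^ 2) = j ^ 2 + j * k + k ^ 2 := by exact_mod_cast hpq
  have hC : (R : ℂ) ^ 2 * (3 * b + a ^ 2) = 4 * Real.pi ^ 2 * ((p : ℂ) ^ 2 + p * q + q ^ 2) := by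
    have d1 : (m₁ - m₂) * R = j * (2 * Real.pi * Complex.I) := by linear_combination hj
    have d2 : (m₂ - m₃) * R = k * (2 * Real.pi * Complex.I) := by linear_combination hk
    have d3 : (R : ℂ) ^ 2 * ((m₁ - m₂) ^ 2 + (m₁ - m₂) * (m₂ - m₃) + (m₂ - m₃) ^ 2) =
        (j ^ 2 + j * k + k ^ 2) * (2 * Real.pi * Complex.I) ^ 2 := by
      have : (R : ℂ) ^ 2 * ((m₁ - m₂) ^ 2 + (m₁ - m₂) * (m₂ - m₃) + (m₂ - m₃) ^ 2) =
        ((m₁ - m₂) * R) ^ 2 + ((m₁ - m₂) * R) * ((m₂ - m₃) * R) + ((m₂ - m₃) * R) ^ 2 := by ring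
      rw [this, d1, d2]; ring
    -- The quadratic form in the differences is symmetric in the roots, hence determined by `Σ mᵢ`
    -- and `Σ mᵢ mⱼ`.
    have d4 : (m₁ - m₂) ^ 2 + (m₁ - m₂) * (m₂ - m₃) + (m₂ - m₃) ^ 2 = -(3 * b + a ^ 2) := by
      have : (m₁ - m₂) ^ 2 + (m₁ - m₂) * (m₂ - m₃) + (m₂ - m₃) ^ 2 =
        (m₁ + m₂ + m₃) ^ 2 - 3 * (m₁ * m₂ + m₁ * m₃ + m₂ * m₃) := by ring
      rw [this, hp, hq]
      linear_combination (a : ℂ) ^ 2 * Complex.I_sq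
    rw [hpq']
    rw [d4] at d3
    linear_combination -d3 -
      4 * Real.pi ^ 2 * ((j : ℂ) ^ 2 + j * k + k ^ 2) * Complex.I_sq
  have hRe : R ^ 2 * (3 * b + a ^ 2) = 4 * Real.pi ^ 2 * ((p : ℝ) ^ 2 + p * q + q ^ 2) := by
    exact_mod_cast hC
  have hp' : (1 : ℝ) ≤ p := by exact_mod_cast hp1
  have hq' : (1 : ℝ) ≤ q := by exact_mod_cast hq1
  have hN : 0 < (p : ℝ) ^ 2 + p * q + q ^ 2 := by positivity
  have hD : 0 < 3 * b + a ^ 2 := by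
    have : 0 < R ^ 2 * (3 * b + a ^ 2) := by rw [hRe]; positivity
    exact pos_of_mul_pos_right this (by positivity)
  refine ⟨hD, p, q, hp1, hq1, ?_⟩
  have : ((p : ℝ) ^ 2 + p * q + q ^ 2) / (3 * b + a ^ 2) = (R / (2 * Real.pi)) ^ 2 := by
    field_simp
    linear_combination -hRe
  rw [this, Real.sqrt_sq (by positivity)]
  field_simp

/-- For noncritical lengths no eigenfunction of `A` has a vanishing derivative at `0`. -/
theorem eigenfunction_eq_zero {a b : ℝ} (hR : 0 < R)
    (hab : 3 * b + a ^ 2 ≤ 0 ∨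
      (0 < 3 * b + a ^ 2 ∧ ∀ k l : ℕ, 1 ≤ k → 1 ≤ l →
        R ≠ 2 * Real.pi *
          Real.sqrt (((k : ℝ) ^ 2 + (k : ℝ) * (l : ℝ) + (l : ℝ) ^ 2) / (3 * b + a ^ 2))))
    {y : L2Interval R} {l : ℂ} (h : HNLSGraph a b R y (l • y))
    (hd : HasDerivTraceAtZero R y 0) : y = 0 := by
  obtain ⟨y₀, y₁, y₂, y₃, h, e0, e0', e1', hz⟩ := h
  have e1 : y₁ 0 = 0 := HasDerivTraceAtZero.unique hR ⟨y₀, y₁, y₂, y₃, h, rfl⟩ hd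
  obtain ⟨m₁, m₂, m₃, hp, hq, hr⟩ := exists_cubic_roots (Complex.I * a) b (-l)
  have heq : ∀ᵐ x ∂volume.restrict (Ioo (0 : ℝ) R),
      y₃ x = Complex.I * a * y₂ x - b * y₁ x + -l * y₀ x := by
    filter_upwards [hz, h.ae_eq, Lp.coeFn_smul l y] with x p1 p2 p3
    rw [p3, Pi.smul_apply, p2, smul_eq_mul] at p1
    linear_combination p1
  -- The relations single out one root, so they are used for all three cyclic orders. If `y''(0) ≠
  -- 0`, the roots are distinct and the exponentials `e^{mᵢ R}` agree.
  have rel : ∀ m₁ m₂ m₃ : ℂ, m₁ + m₂ + m₃ = Complex.I * a →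
      m₁ * m₂ + m₁ * m₃ + m₂ * m₃ = b → m₁ * m₂ * m₃ = -l → _ := fun m₁ m₂ m₃ hp hq hr =>
    characteristic_relations (m₁ := m₁) (m₂ := m₂) (m₃ := m₃) hR (h.hasACDeriv_zero hR.le)
      (h.hasACDeriv_one hR.le) (h.hasACDeriv_two hR.le) (by rwa [hp, hq, hr]) e0 e1 e0' e1'
  obtain ⟨r1, r2, r3⟩ := rel m₁ m₂ m₃ hp hq hr
  obtain ⟨s1, s2, -⟩ := rel m₂ m₃ m₁ (by rw [← hp]; ring) (by rw [← hq]; ring) (by rw [← hr]; ring)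
  obtain ⟨t1, t2, -⟩ := rel m₃ m₁ m₂ (by rw [← hp]; ring) (by rw [← hq]; ring) (by rw [← hr]; ring)
  have hα : y₂ 0 = 0 := by
    by_contra hα
    obtain ⟨hD, k, n, hk, hn, hRkn⟩ := critical_length_of_exp_eq hR hp hq (fun e => hα (r2 e))
      (fun e => hα (s2 e)) (fun e => hα (t2 e.symm))
      (mul_right_cancel₀ hα (r1.symm.trans s1)) (mul_right_cancel₀ hα (s1.symm.trans t1))
    rcases hab with h' | ⟨-, h'⟩
    · exact hD.not_ge h'
    · exact h' k n hk hn hRkn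
  refine Lp.ext ?_
  have hI := ae_restrict_mem (μ := volume) (measurableSet_Ioo (a := (0 : ℝ)) (b := R))
  filter_upwards [h.ae_eq, hI, Lp.coeFn_zero ℂ 2 (volume.restrict (Ioo (0 : ℝ) R))] with x p1 p2 p3
  rw [p1, p3, r3 hα x (Ioo_subset_Icc_self p2), Pi.zero_apply]

end

/-! ### Volterra and multiplication operators; compactness of the semigroup. -/

section

variable {R : ℝ}

theorem L2Interval.hasACDeriv_integral (hR : 0 ≤ R) (w : L2Interval R) :
    HasACDeriv R (fun x => ∫ s in (0 : ℝ)..x, w s) w :=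
  ⟨L2Interval.intervalIntegrable hR (Lp.memLp w), fun x _ => by simp⟩

/-- The element `g` of `L₂` representing the functional `w ↦ ∫₀ˣ w`. -/
theorem L2Interval.exists_inner_eq_integral (hR : 0 ≤ R) {x : ℝ} (hx : x ∈ Icc (0 : ℝ) R) :
    ∃ g : L2Interval R, ‖g‖ ^ 2 ≤ R ∧
      ∀ w : L2Interval R, inner ℂ g w = ∫ s in (0 : ℝ)..x, w s := by
  have hm : MemLp ((Iio x).indicator fun _ => (1 : ℂ)) 2 (volume.restrict (Ioo (0 : ℝ) R)) :=
    (memLp_const (1 : ℂ)).indicator measurableSet_Iio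
  refine ⟨hm.toLp _, ?_, fun w => ?_⟩
  · rw [L2Interval.norm_sq_eq hR hm.coeFn_toLp]
    have : ∫ s in (0 : ℝ)..R, ‖(Iio x).indicator (fun _ => (1 : ℂ)) s‖ ^ 2 ≤
        ∫ _ in (0 : ℝ)..R, (1 : ℝ) := by
      have h1 : ∀ s, ‖(Iio x).indicator (fun _ => (1 : ℂ)) s‖ ^ 2 =
          (Iio x).indicator (fun _ => (1 : ℝ)) s := fun s => by
        by_cases hs : s ∈ Iio x <;> simp [hs]
      simp only [h1]
      refine intervalIntegral.integral_mono_on hR ?_ intervalIntegrable_const fun s _ =>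
        indicator_le_self' (fun _ _ => zero_le_one) s
      exact ⟨(intervalIntegrable_const (μ := volume) (a := 0) (b := R)).1.indicator
        measurableSet_Iio, (intervalIntegrable_const (μ := volume) (a := 0) (b := R)).2.indicator
        measurableSet_Iio⟩
    simpa using this
  · rw [L2.inner_def, intervalIntegral.integral_of_le hx.1]
    have h1 : (fun s => inner ℂ (hm.toLp _ s) (w s)) =ᵐ[volume.restrict (Ioo (0 : ℝ) R)]
        (Iio x).indicator w := by
      filter_upwards [hm.coeFn_toLp] with s hs
      rw [hs]
      by_cases hsx : s ∈ Iio x <;> simp [hsx]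
    rw [integral_congr_ae h1, integral_indicator measurableSet_Iio, Measure.restrict_restrict
      measurableSet_Iio]
    have h2 : Iio x ∩ Ioo 0 R = Ioo 0 x := by
      ext s
      simp only [mem_inter_iff, mem_Iio, mem_Ioo]
      exact ⟨fun h => ⟨h.2.1, h.1⟩, fun h => ⟨h.2, h.1, h.2.trans_le hx.2⟩⟩
    rw [h2, integral_Ioc_eq_integral_Ioo]

theorem exists_volterra (hR : 0 < R) : ∃ V : L2Interval R →L[ℂ] L2Interval R,
    ∀ w, ∀ᵐ x ∂(volume.restrict (Ioo (0 : ℝ) R)), V w x = ∫ s in (0 : ℝ)..x, w s := by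
  have hmem : ∀ w : L2Interval R, MemLp (fun x => ∫ s in (0 : ℝ)..x, w s) 2
      (volume.restrict (Ioo (0 : ℝ) R)) := fun w =>
    L2Interval.memLp_of_continuousOn (L2Interval.hasACDeriv_integral hR.le w).continuousOn
  have hI := ae_restrict_mem (μ := volume) (measurableSet_Ioo (a := (0 : ℝ)) (b := R))
  choose! g hg hgw using fun (x : ℝ) (hx : x ∈ Icc (0 : ℝ) R) =>
    L2Interval.exists_inner_eq_integral hR.le hx
  let V₀ : L2Interval R →ₗ[ℂ] L2Interval R :=
    { toFun := fun w => (hmem w).toLp _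
      map_add' := fun u w => by
        refine Lp.ext ?_
        filter_upwards [(hmem (u + w)).coeFn_toLp, Lp.coeFn_add ((hmem u).toLp _) ((hmem w).toLp _),
          (hmem u).coeFn_toLp, (hmem w).coeFn_toLp, hI] with x h1 h2 h3 h4 h5
        have hx := Ioo_subset_Icc_self h5
        rw [h1, h2, Pi.add_apply, h3, h4, ← hgw x hx, ← hgw x hx, ← hgw x hx, inner_add_right]
      map_smul' := fun c w => by
        refine Lp.ext ?_
        filter_upwards [(hmem (c • w)).coeFn_toLp, Lp.coeFn_smul c ((hmem w).toLp _),
          (hmem w).coeFn_toLp, hI] with x h1 h2 h3 h5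
        have hx := Ioo_subset_Icc_self h5
        rw [h1, RingHom.id_apply, h2, Pi.smul_apply, h3, ← hgw x hx, ← hgw x hx, inner_smul_right,
          smul_eq_mul] }
  refine ⟨V₀.mkContinuous R fun w => ?_, fun w => (hmem w).coeFn_toLp⟩
  have h1 : ‖V₀ w‖ ^ 2 ≤ (R * ‖w‖) ^ 2 := by
    rw [L2Interval.norm_sq_eq hR.le (u := V₀ w) (hmem w).coeFn_toLp]
    have hc := (L2Interval.hasACDeriv_integral hR.le w).continuousOn
    rw [← uIcc_of_le hR.le] at hc
    have hi : IntervalIntegrable (fun x => ‖∫ s in (0 : ℝ)..x, w s‖ ^ 2) volume 0 R :=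
      (hc.norm.pow 2).intervalIntegrable
    -- The pointwise bound `|∫₀ˣ w|² ≤ R ‖w‖²`, integrated over length `R`, gives operator norm at
    -- most `R`.
    have := intervalIntegral.integral_mono_on hR.le hi
      (intervalIntegrable_const (c := R * ‖w‖ ^ 2)) fun x hx => by
        rw [← hgw x hx]
        calc ‖inner ℂ (g x) w‖ ^ 2 ≤ (‖g x‖ * ‖w‖) ^ 2 := by
              gcongr; exact norm_inner_le_norm _ _
          _ = ‖g x‖ ^ 2 * ‖w‖ ^ 2 := by ring
          _ ≤ R * ‖w‖ ^ 2 := by gcongr; exact hg x hx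
    refine this.trans_eq ?_
    rw [intervalIntegral.integral_const]
    simp only [sub_zero, smul_eq_mul]; ring
  exact (sq_le_sq₀ (norm_nonneg _) (by positivity)).1 h1

/-- The Volterra operator maps weakly null sequences to null sequences. -/
theorem tendsto_volterra (hR : 0 < R) {V : L2Interval R →L[ℂ] L2Interval R}
    (hV : ∀ w, ∀ᵐ x ∂(volume.restrict (Ioo (0 : ℝ) R)), V w x = ∫ s in (0 : ℝ)..x, w s)
    {w : ℕ → L2Interval R} (hw : ∃ K, ∀ n, ‖w n‖ ≤ K)
    (hw0 : ∀ g, Tendsto (fun n => inner ℂ g (w n)) atTop (𝓝 0)) :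
    Tendsto (fun n => V (w n)) atTop (𝓝 0) := by
  obtain ⟨K, hK⟩ := hw
  have hK0 : 0 ≤ K := (norm_nonneg _).trans (hK 0)
  choose! g hg hgw using fun (x : ℝ) (hx : x ∈ Icc (0 : ℝ) R) =>
    L2Interval.exists_inner_eq_integral hR.le hx
  have hlim : Tendsto (fun n => ‖V (w n)‖ ^ 2) atTop (𝓝 0) := by
    have e : ∀ n, ‖V (w n)‖ ^ 2 = ∫ x in (0 : ℝ)..R, ‖∫ s in (0 : ℝ)..x, w n s‖ ^ 2 := fun n =>
      L2Interval.norm_sq_eq hR.le (hV (w n))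
    simp only [e]
    -- Each value `∫₀ˣ w n` is an inner product with a fixed vector, so it tends to zero for every
    -- `x`.
    have := intervalIntegral.tendsto_integral_filter_of_dominated_convergence (μ := volume)
      (a := 0) (b := R) (l := atTop) (F := fun n x => ‖∫ s in (0 : ℝ)..x, w n s‖ ^ 2)
      (f := fun _ => (0 : ℝ)) (fun _ => R * K ^ 2)
      (Eventually.of_forall fun n => by
        have hc := (L2Interval.hasACDeriv_integral hR.le (w n)).continuousOn
        rw [← uIcc_of_le hR.le] at hc
        exact ((hc.norm.pow 2).mono uIoc_subset_uIcc).aestronglyMeasurable measurableSet_uIoc)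
      (Eventually.of_forall fun n => Eventually.of_forall fun x hx => by
        rw [uIoc_of_le hR.le] at hx
        have hx' := Ioc_subset_Icc_self hx
        rw [Real.norm_of_nonneg (by positivity), ← hgw x hx']
        calc ‖inner ℂ (g x) (w n)‖ ^ 2 ≤ (‖g x‖ * ‖w n‖) ^ 2 := by
              gcongr; exact norm_inner_le_norm _ _
          _ = ‖g x‖ ^ 2 * ‖w n‖ ^ 2 := by ring
          _ ≤ R * K ^ 2 := by gcongr; exacts [hg x hx', hK n])
      intervalIntegrable_const
      (Eventually.of_forall fun x hx => by
        rw [uIoc_of_le hR.le] at hx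
        have hx' := Ioc_subset_Icc_self hx
        have := (hw0 (g x)).norm.pow 2
        simpa [hgw x hx'] using this)
    simpa using this
  rw [tendsto_zero_iff_norm_tendsto_zero]
  have := hlim.sqrt
  simpa only [Real.sqrt_sq (norm_nonneg _), Real.sqrt_zero] using this

theorem exists_mul_id (R : ℝ) : ∃ M : L2Interval R →L[ℂ] L2Interval R,
    ∀ w, ∀ᵐ x ∂(volume.restrict (Ioo (0 : ℝ) R)), M w x = (x : ℂ) * w x := by
  have hb : ∀ᵐ x : ℝ ∂(volume.restrict (Ioo (0 : ℝ) R)), ‖(x : ℂ)‖ ≤ R := by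
    filter_upwards [ae_restrict_mem (μ := volume) (measurableSet_Ioo (a := (0 : ℝ)) (b := R))]
      with x hx
    rw [Complex.norm_real, Real.norm_of_nonneg hx.1.le]
    exact hx.2.le
  have hmeas : AEStronglyMeasurable (fun x : ℝ => (x : ℂ)) (volume.restrict (Ioo (0 : ℝ) R)) :=
    Complex.continuous_ofReal.aestronglyMeasurable
  have hmem : ∀ w : L2Interval R, MemLp (fun x : ℝ => (x : ℂ) * w x) 2
      (volume.restrict (Ioo (0 : ℝ) R)) := fun w =>
    MemLp.of_le_mul (Lp.memLp w) (c := R)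
      (hmeas.mul (Lp.memLp w).1) (by
        filter_upwards [hb] with x hx
        rw [norm_mul]
        exact mul_le_mul_of_nonneg_right hx (norm_nonneg _))
  let M₀ : L2Interval R →ₗ[ℂ] L2Interval R :=
    { toFun := fun w => (hmem w).toLp _
      map_add' := fun u w => by
        refine Lp.ext ?_
        filter_upwards [(hmem (u + w)).coeFn_toLp, Lp.coeFn_add ((hmem u).toLp _) ((hmem w).toLp _),
          (hmem u).coeFn_toLp, (hmem w).coeFn_toLp, Lp.coeFn_add u w] with x h1 h2 h3 h4 h5
        rw [h1, h2, Pi.add_apply, h3, h4, h5, Pi.add_apply, mul_add]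
      map_smul' := fun c w => by
        refine Lp.ext ?_
        filter_upwards [(hmem (c • w)).coeFn_toLp, Lp.coeFn_smul c ((hmem w).toLp _),
          (hmem w).coeFn_toLp, Lp.coeFn_smul c w] with x h1 h2 h3 h5
        rw [h1, RingHom.id_apply, h2, Pi.smul_apply, h3, h5, Pi.smul_apply, smul_eq_mul,
          smul_eq_mul]
        ring }
  refine ⟨M₀.mkContinuous R fun w => ?_, fun w => (hmem w).coeFn_toLp⟩
  refine Lp.norm_le_mul_norm_of_ae_le_mul ?_
  filter_upwards [(hmem w).coeFn_toLp, hb] with x h1 h2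
  change ‖(hmem w).toLp _ x‖ ≤ _
  rw [h1, norm_mul]
  exact mul_le_mul_of_nonneg_right h2 (norm_nonneg _)

theorem inner_mul_id_comm {M : L2Interval R →L[ℂ] L2Interval R}
    (hM : ∀ w, ∀ᵐ x ∂(volume.restrict (Ioo (0 : ℝ) R)), M w x = (x : ℂ) * w x)
    (u w : L2Interval R) : inner ℂ (M u) w = inner ℂ u (M w) := by
  rw [L2.inner_def, L2.inner_def]
  refine integral_congr_ae ?_
  filter_upwards [hM u, hM w] with x h1 h2
  rw [h1, h2, RCLike.inner_apply, RCLike.inner_apply, map_mul, Complex.conj_ofReal]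
  ring

/-- The semigroup generated by `A` is compact for positive times. -/
theorem exists_convergent_subseq_semigroup {a b : ℝ} (hR : 0 < R)
    {S : ℝ → L2Interval R →L[ℂ] L2Interval R} (hS : IsC0Semigroup S)
    (hA : IsGeneratorGraph S (fun y z => (y, z) ∈ hnlsSubmodule a b hR)) {t : ℝ} (ht : 0 < t)
    {u : ℕ → L2Interval R} (hu : ∀ n, ‖u n‖ ≤ 1) :
    ∃ φ : ℕ → ℕ, StrictMono φ ∧ ∃ v, Tendsto (fun n => S t (u (φ n))) atTop (𝓝 v) := by
  obtain ⟨M, hM⟩ := exists_mul_id R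
  obtain ⟨V, hV⟩ := exists_volterra hR
  have hG := isMaximalDissipative_hnlsSubmodule a b hR
  have : Fact ((2 : ENNReal) ≠ ⊤) := ⟨by norm_num⟩
  obtain ⟨φ, hφ, v, hv⟩ := exists_weakly_convergent_subseq hu
  refine ⟨φ, hφ, S t v, ?_⟩
  -- The multiplication operator plays `M` and the Volterra operator plays `V`. Kato's inequality
  -- bounds the `∫ |y'|²` produced by interpolation.
  have key := hA.tendsto_zero_of_weakly_null hG hS (M := M) (V := V) (C := a ^ 2 + |b|)
    (inner_mul_id_comm hM) (fun y z h ε hε => ?_) (fun w h1 h2 => tendsto_volterra hR hV h1 h2) ht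
    (w := fun n => u (φ n) - v) ⟨1 + ‖v‖, fun n => (norm_sub_le _ _).trans
      (add_le_add_left (hu _) _)⟩ hv
  · rw [tendsto_iff_norm_sub_tendsto_zero]
    have := key.norm
    simpa only [map_sub, norm_zero] using this
  · obtain ⟨y₀, y₁, y₂, y₃, h, e0, e1, e2, hz⟩ := h
    have h1 := kato_inequality hR h e0 e1 e2 hz (hM y)
    have h2 := norm_sq_le_interpolation hR h.ae_eq (h.hasACDeriv_zero hR.le)
      (h.hasACDeriv_one hR.le).continuousOn e0 e1 (hV y) hε
    have h3 : 0 ≤ ∫ x in (0 : ℝ)..R, ‖y₁ x‖ ^ 2 :=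
      intervalIntegral.integral_nonneg hR.le fun _ _ => by positivity
    have h4 : ε * (∫ x in (0 : ℝ)..R, ‖y₁ x‖ ^ 2) ≤
        ε * ((a ^ 2 + |b|) * ‖y‖ ^ 2 - 2 * (inner ℂ (M y) z).re) :=
      mul_le_mul_of_nonneg_left (by linarith) hε.le
    have h5 : 1 / (4 * ε) * ‖V y‖ ^ 2 ≤ 1 / ε * ‖V y‖ ^ 2 := by
      gcongr
      linarith
    linarith

end

/-! ### The boundary trace operator. -/

section

variable {R : ℝ}

/-- On the domain of `A` the trace `y'(0)` is a bounded functional of `y - A y`. -/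
theorem exists_trace_functional (a b : ℝ) (hR : 0 < R) : ∃ ψ : L2Interval R →L[ℂ] ℂ,
    ∀ y z, HNLSGraph a b R y z → HasDerivTraceAtZero R y (ψ (y - z)) := by
  have hG := isMaximalDissipative_hnlsSubmodule a b hR
  obtain ⟨J, hJ1, hJ2, hJ3⟩ := hG.exists_resolvent one_pos
  simp only [Complex.ofReal_one, one_smul, one_mul] at hJ1 hJ2 hJ3
  have htr : ∀ f, ∃ d, HasDerivTraceAtZero R (J f) d := fun f => by
    obtain ⟨y₀, y₁, y₂, y₃, h, _⟩ := hJ1 f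
    exact ⟨y₁ 0, y₀, y₁, y₂, y₃, h, rfl⟩
  choose d hd using htr
  let ψ₀ : L2Interval R →ₗ[ℂ] ℂ :=
    { toFun := d
      map_add' := fun f g => by
        refine HasDerivTraceAtZero.unique hR (hd (f + g)) ?_
        rw [map_add]
        exact (hd f).add hR.le (hd g)
      map_smul' := fun c f => by
        refine HasDerivTraceAtZero.unique hR (hd (c • f)) ?_
        rw [map_smul]
        exact (hd f).smul hR.le c }
  refine ⟨ψ₀.mkContinuous 2 fun f => ?_, fun y z h => ?_⟩
  · have h1 := two_mul_re_inner_eq hR (hJ1 f) (hd f)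
    have h2 : |(inner ℂ (J f - f) (J f)).re| ≤ ‖J f - f‖ * ‖J f‖ :=
      (Complex.abs_re_le_norm _).trans (norm_inner_le_norm _ _)
    have h3 := (abs_le.1 h2).1
    have h4 := norm_sub_le (J f) f
    have h5 := hJ3 f
    -- The energy identity gives `|y'(0)|² = -2 Re ⟨J f - f, J f⟩ ≤ 2 · 2‖f‖ · ‖f‖`.
    have h6 : ‖d f‖ ^ 2 ≤ (2 * ‖f‖) ^ 2 := by
      have : ‖J f - f‖ * ‖J f‖ ≤ (2 * ‖f‖) * ‖f‖ :=
        mul_le_mul (by linarith) h5 (norm_nonneg _) (by positivity)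
      nlinarith
    exact (sq_le_sq₀ (norm_nonneg _) (by positivity)).1 h6
  · have h1 := hd (y - z)
    rw [hJ2 y z h] at h1
    exact h1

/-- Existence of the boundary trace operator, with the energy identity. -/
theorem exists_boundaryTrace (a b : ℝ) (hR : 0 < R) {T : ℝ} (hT : 0 < T)
    {S : ℝ → L2Interval R →L[ℂ] L2Interval R} (hS : IsC0Semigroup S)
    (hA : IsGeneratorGraph S (fun y z => (y, z) ∈ hnlsSubmodule a b hR)) :
    ∃ P : L2Interval R →L[ℂ] L2Interval T,
      (∀ x, (∃ z, HNLSGraph a b R x z) →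
        ∀ᵐ t ∂(volume.restrict (Ioo (0 : ℝ) T)), HasDerivTraceAtZero R (S t x) (P x t)) ∧
      ∀ x, ‖P x‖ ^ 2 = ‖x‖ ^ 2 - ‖S T x‖ ^ 2 := by
  have hG := isMaximalDissipative_hnlsSubmodule a b hR
  obtain ⟨ψ, hψ⟩ := exists_trace_functional a b hR
  let D : Submodule ℂ (L2Interval R) := (hnlsSubmodule a b hR).map (LinearMap.fst ℂ _ _)
  have hDmem : ∀ x, x ∈ D ↔ ∃ z, (x, z) ∈ hnlsSubmodule a b hR := fun x => by simp [D]
  have hDdense : Dense (D : Set (L2Interval R)) := by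
    have : (D : Set (L2Interval R)) = {x | ∃ z, (x, z) ∈ hnlsSubmodule a b hR} := by
      ext x; exact hDmem x
    rw [this]; exact hG.dense
  choose A hAx using fun x : D => (hDmem x).1 x.2
  have hcont : ∀ f, ContinuousOn (fun t => ψ (S t f)) (Icc 0 T) := fun f =>
    ψ.continuous.comp_continuousOn (IsGeneratorGraph.continuousOn_orbit hS f T)
  have hmem : ∀ f, MemLp (fun t => ψ (S t f)) 2 (volume.restrict (Ioo (0 : ℝ) T)) := fun f =>
    L2Interval.memLp_of_continuousOn (hcont f)
  -- Since `S(t)` commutes with `1 - A` on the domain, the trace of `S(t) x` is `ψ (S(t) (x - A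
  -- x))`, which is continuous in `t`.
  let P₀ : D →ₗ[ℂ] L2Interval T :=
    { toFun := fun x => (hmem (x - A x)).toLp _
      map_add' := fun x y => by
        have e : ((x + y : D) : L2Interval R) - A (x + y) = (x - A x) + (y - A y) := by
          rw [hG.eq_of_mem (hAx (x + y)) (Submodule.add_mem _ (hAx x) (hAx y)), Submodule.coe_add]
          abel
        refine Lp.ext ?_
        filter_upwards [(hmem (((x + y : D) : L2Interval R) - A (x + y))).coeFn_toLp,
          Lp.coeFn_add ((hmem (x - A x)).toLp _) ((hmem (y - A y)).toLp _),
          (hmem (x - A x)).coeFn_toLp, (hmem (y - A y)).coeFn_toLp] with t h1 h2 h3 h4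
        rw [h1, h2, Pi.add_apply, h3, h4, e, map_add, map_add]
      map_smul' := fun c x => by
        have e : ((c • x : D) : L2Interval R) - A (c • x) = c • (x - A x) := by
          rw [hG.eq_of_mem (hAx (c • x)) (Submodule.smul_mem _ c (hAx x)), Submodule.coe_smul,
            smul_sub]
        refine Lp.ext ?_
        filter_upwards [(hmem (((c • x : D) : L2Interval R) - A (c • x))).coeFn_toLp,
          Lp.coeFn_smul c ((hmem (x - A x)).toLp _),
          (hmem (x - A x)).coeFn_toLp] with t h1 h2 h3
        rw [h1, RingHom.id_apply, h2, Pi.smul_apply, h3, e, map_smul, map_smul] }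
  have htrace : ∀ (x : D) (t : ℝ), 0 ≤ t → HasDerivTraceAtZero R (S t x) (ψ (S t (x - A x))) := by
    intro x t ht
    rw [map_sub]
    exact hψ _ _ (hA.mem hS (hAx x) ht)
  have henergy : ∀ x : D, ‖P₀ x‖ ^ 2 = ‖(x : L2Interval R)‖ ^ 2 - ‖S T x‖ ^ 2 := by
    intro x
    rw [L2Interval.norm_sq_eq hT.le (u := P₀ x) (hmem (x - A x)).coeFn_toLp]
    have h1 := hA.integral_re_inner hS (ContinuousLinearMap.id ℂ _) (hAx x) hT.le
    simp only [ContinuousLinearMap.id_apply] at h1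
    have h2 : ∀ y : L2Interval R, (inner ℂ y y).re = ‖y‖ ^ 2 := fun y =>
      inner_self_eq_norm_sq (𝕜 := ℂ) y
    rw [h2, h2] at h1
    have h3 : ∫ t in (0 : ℝ)..T, ((inner ℂ (S t x) (S t (A x))).re +
        (inner ℂ (S t (A x)) (S t x)).re) = ∫ t in (0 : ℝ)..T, -‖ψ (S t (x - A x))‖ ^ 2 := by
      refine intervalIntegral.integral_congr fun t ht => ?_
      rw [uIcc_of_le hT.le] at ht
      have h4 := two_mul_re_inner_eq hR (hA.mem hS (hAx x) ht.1) (htrace x t ht.1)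
      have h5 : (inner ℂ (S t x) (S t (A x))).re = (inner ℂ (S t (A x)) (S t x)).re :=
        inner_re_symm (𝕜 := ℂ) _ _
      simp only [h5, ← h4]
      ring
    rw [h3, intervalIntegral.integral_neg] at h1
    linarith
  have hbound : ∀ x : D, ‖P₀ x‖ ≤ 1 * ‖x‖ := fun x => by
    rw [one_mul]
    refine (sq_le_sq₀ (norm_nonneg _) (norm_nonneg _)).1 ?_
    rw [henergy]
    have : ‖(x : L2Interval R)‖ = ‖x‖ := rfl
    rw [this]
    linarith [sq_nonneg ‖S T x‖]
  have hdr : DenseRange D.subtypeL := by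
    rw [DenseRange]
    simpa using hDdense
  have hui : IsUniformInducing D.subtypeL := isUniformEmbedding_subtype_val.isUniformInducing
  let P := (P₀.mkContinuous 1 hbound).extend D.subtypeL
  have hP : ∀ x : D, P x = P₀ x := fun x =>
    ContinuousLinearMap.extend_eq (P₀.mkContinuous 1 hbound) hdr hui x
  refine ⟨P, fun x hx => ?_, fun x => ?_⟩
  · lift x to D using (hDmem x).2 hx
    have h1 : P x =ᵐ[volume.restrict (Ioo (0 : ℝ) T)] fun t => ψ (S t (x - A x)) := by
      rw [hP]; exact (hmem (x - A x)).coeFn_toLp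
    filter_upwards [h1, ae_restrict_mem measurableSet_Ioo] with t h2 h3
    rw [h2]
    exact htrace x t h3.1.le
  · refine hDdense.induction (P := fun x => ‖P x‖ ^ 2 = ‖x‖ ^ 2 - ‖S T x‖ ^ 2) (fun x hx => ?_)
      (isClosed_eq (by fun_prop) (by fun_prop)) x
    lift x to D using hx
    rw [hP, henergy]

end

/-! ### Uniqueness of the trace operator and the observability inequality. -/

theorem lemma5 (a b R : ℝ) (hR : 0 < R)
    (hab : 3 * b + a ^ 2 ≤ 0 ∨
      (0 < 3 * b + a ^ 2 ∧ ∀ k l : ℕ, 1 ≤ k → 1 ≤ l →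
        R ≠ 2 * Real.pi *
          Real.sqrt (((k : ℝ) ^ 2 + (k : ℝ) * (l : ℝ) + (l : ℝ) ^ 2) / (3 * b + a ^ 2))))
    (T : ℝ) (hT : 0 < T) :
    ∃ P : L2Interval R →L[ℂ] L2Interval T,
      IsBoundaryTraceOperator a b R T P ∧
      (∀ Q : L2Interval R →L[ℂ] L2Interval T, IsBoundaryTraceOperator a b R T Q → Q = P) ∧
      ∃ c : ℝ, 0 < c ∧ ∀ u₀ : L2Interval R, ‖u₀‖ ≤ c * ‖P u₀‖ := by
  have hG := isMaximalDissipative_hnlsSubmodule a b hR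
  obtain ⟨S, hS, hA, -⟩ := hG.exists_semigroup
  obtain ⟨P, hP, hE⟩ := exists_boundaryTrace a b hR hT hS hA
  refine ⟨P, ⟨S, hS, hA, hP⟩, ?_, ?_⟩
  · rintro Q ⟨S', hS', hA', hQ⟩
    ext1 x
    refine hG.dense.induction (P := fun x => Q x = P x) (fun x hx => ?_)
      (isClosed_eq Q.continuous P.continuous) x
    refine Lp.ext ?_
    filter_upwards [hP x hx, hQ x hx, ae_restrict_mem measurableSet_Ioo] with t h1 h2 h3
    rw [IsGeneratorGraph.semigroup_unique hG hA' hS' hA hS h3.1.le] at h2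
    exact h2.unique hR h1
  · obtain ⟨ρ, hρ0, hρ1, hρ⟩ := hA.exists_norm_le_mul hG hS
      (fun t ht u hu => exists_convergent_subseq_semigroup hR hS hA ht hu)
      (fun y l h h0 => by
        obtain ⟨y₀, y₁, y₂, y₃, h', _⟩ := id h
        have h1 := two_mul_re_inner_eq hR h ⟨_, _, _, _, h', rfl⟩
        rw [h0, mul_zero] at h1
        have h2 : y₁ 0 = 0 := by simpa using h1
        exact eigenfunction_eq_zero hR hab h ⟨_, _, _, _, h', h2⟩) hT
    have hpos : 0 < 1 - ρ ^ 2 := by nlinarith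
    -- The energy identity and the strict contraction give `‖P u‖² ≥ (1 - ρ²) ‖u‖²`.
    refine ⟨(Real.sqrt (1 - ρ ^ 2))⁻¹, by positivity, fun u => ?_⟩
    rw [inv_mul_eq_div, le_div_iff₀ (by positivity), mul_comm]
    refine (sq_le_sq₀ (by positivity) (norm_nonneg _)).1 ?_
    rw [mul_pow, Real.sq_sqrt hpos.le, hE]
    have := pow_le_pow_left₀ (norm_nonneg _) (hρ u) 2
    rw [mul_pow] at this
    linarith
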